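/- **Setting.** Consider the Minotaur hybrid PoW/PoS protocol in the lock-step synchronous model (whatever an honest party creates or receives in a slot is known to all honest parties in the next slot), run in epochs of $R$ slots. Its parameters are the active-slots coefficient $f\in(0,1)$, the weight $\omega\in[0,1]$ of work, the fork limit $k$, the expected PoW block rate, the confirmation depth and the recency parameter. * *Leader election.* In each slot, independently over slots and parties, a party with relative virtual stake $\alpha$ is elected with probability $1-(1-f)^{\alpha}$ and may then append a main-chain block. * *Virtual stake.* In epochs $1,2$ the virtual stake is the initial stake distribution. In an epoch $e\ge 3$ a party with share $s$ of the actual stake and share $w$ of the total difficulty of the PoW blocks referenced by the chain in epoch $e-2$ has relative virtual stake $(1-\omega)s+\omega w$ (just $s$ if no PoW block was referenced). * *PoW.* Every active miner makes one hash query per slot, with the mining target of the epoch; this target is adjusted in every epoch to the referenced difficulty. * *Chain selection* (maxvalid-mc). An honest party holds the longest chains among those in its view that fork from its current chain by at most $k$ blocks. * *Bounded adversary.* The adversary is $(\theta,m,\omega)$-bounded if $\omega\beta_w^W+(1-\omega)\beta_s^W\le\theta$ for every window $W$ of at most $m$ slots, where $\beta_w^W,\beta_s^W$ are the maximal adversarial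 fractions of mining power and of stake in $W$. It decides on its actions in a slot without knowing the random values of that or later slots. * *Common prefix* with parameter $\ell$: whenever honest parties hold chains $C_1,C_2$ at slots $r_1\le r_2$, the chain $C_1$ without its blocks with timestamps in the last $\ell$ slots (that is, in $r_1-\ell+1,\dots,r_1$) is a prefix of $C_2$. **Proposition.** There is an absolute constant $c>0$ such that for every $f\in(0,1)$ there is $\ell_0$ with the following property. Let $\ell_{\rm cp}\ge\ell_0$ and $0\le\delta\le 1/\sqrt{\ell_{\rm cp}}$, and consider the protocol with this $f$, with any $k\ge\ell_{\rm cp}$ and $R\ge 2\ell_{\rm cp}$, and with any admissible values of the other parameters. 1. For every $m$ there are an environment and a $(1/2-\delta,m,\omega)$-bounded adversary such that, with probability at least $c$, common prefix with parameter $\ell_{\rm cp}$ is violated within the first epoch. The other standing assumptions can be met as well, for any prescribed $\gamma\ge1$, $\alpha_0\in(0,1]$ and $\varepsilon\in(0,1)$: the initial adversarial stake fraction is at most $1/2-\delta$; the numbers $h_r$ of honest and $n_r$ of all miners in slot $r$ change by at most a factor $\gamma$ within any $2R$ consecutive slots; $h_r\ge\alpha_0n_r$ for all $r$; and the estimate $\tilde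 h_1$ of $h_1$ satisfies $h_1/((1+\varepsilon)\gamma^2)\le\tilde h_1\le\gamma^2h_1/((1-\varepsilon)\alpha_0)$. 2. More generally, take any epoch and any distribution of stake and mining power, and suppose that at the start of the epoch all honest parties agree on one chain (every other chain known to all of them being strictly shorter), according to which the adversary's relative virtual stake for this epoch lies in $[1/2-\delta,1/2]$. Then there is an adversarial strategy from this point on that violates common prefix with parameter $\ell_{\rm cp}$ within this epoch with probability at least $c$. In particular, $\delta^2\ell_{\rm cp}$ has to exceed a positive constant if common prefix is to hold except with small probability. -/

import Mathlib

namespace Minotaur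

noncomputable section

/-- Protocol parameters: active-slots coefficient `f` of the main-chain lottery, weight `ω` of
work, expected PoW block rate `fw`, epoch length `R`, fork limit `k` (in blocks) of the chain
selection rule `maxvalid-mc`, confirmation depth `κ` (in slots), recency parameter `slRe`. -/
structure Params where
  f : ℝ
  ω : ℝ
  fw : ℝ
  R : ℕ
  k : ℕ
  κ : ℕ
  slRe : ℕ
  f_pos : 0 < f
  f_lt_one : f < 1
  ω_nonneg : 0 ≤ ω
  ω_le_one : ω ≤ 1
  fw_pos : 0 < fw
  κ_lt_R : κ < R

/-- Who takes part: the corrupted parties, the actual stake of every party, the honest and the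
corrupted miners that are active in every slot (one hash query each), and the estimate `hEst` of
the initial honest mining power that is stored in the genesis block.  Slots are `1, 2, 3, …`. -/
structure Setup (P : Type) [Fintype P] where
  corrupt : Finset P
  stake : P → ℝ
  stake_nonneg : ∀ i, 0 ≤ stake i
  stake_pos : 0 < ∑ i, stake i
  honestMiners : ℕ → Finset P
  corruptMiners : ℕ → Finset P
  honestMiners_honest : ∀ r, Disjoint (honestMiners r) corrupt
  corruptMiners_corrupt : ∀ r, corruptMiners r ⊆ corrupt
  miners_pos : ∀ r, 0 < (honestMiners r).card + (corruptMiners r).card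
  hEst : ℝ
  hEst_pos : 0 < hEst

/-! ### Adversarial resources -/

section Resources

variable {P : Type} [Fintype P]

/-- Number `h_r` of honest PoW queries in slot `r`. -/
def Setup.h (S : Setup P) (r : ℕ) : ℝ := (S.honestMiners r).card

/-- Number `n_r` of all PoW queries in slot `r`. -/
def Setup.n (S : Setup P) (r : ℕ) : ℝ := (S.honestMiners r).card + (S.corruptMiners r).card

/-- The adversarial fraction of actual stake. No stake transfers are issued, so this is the
fraction in every view at every slot. -/
def Setup.betaS (S : Setup P) : ℝ := (∑ i ∈ S.corrupt, S.stake i) / ∑ i, S.stake i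

/-- The maximal adversarial fraction of mining power in the slots of the window `[a, b]`. -/
def Setup.betaW (S : Setup P) (a b : ℕ) (hab : a ≤ b) : ℝ :=
  (Finset.Icc a b).sup' (Finset.nonempty_Icc.mpr hab) (fun r => 1 - S.h r / S.n r)

/-- The adversary is `(θ, m, ω)`-bounded: `ω β_w^W + (1 - ω) β_s^W ≤ θ` for every time window
`W` of at most `m` slots. -/
def Setup.Bounded (S : Setup P) (θ : ℝ) (m : ℕ) (ω : ℝ) : Prop :=
  ∀ (a b : ℕ) (hab : a ≤ b), 1 ≤ a → b + 1 ≤ a + m →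
    ω * S.betaW a b hab + (1 - ω) * S.betaS ≤ θ

/-- A sequence (indexed by the slots) is `(γ, s)`-respecting. -/
def Respecting (γ : ℝ) (s : ℕ) (x : ℕ → ℝ) : Prop :=
  ∀ r r' : ℕ, 1 ≤ r → 1 ≤ r' → r < r' + s → r' < r + s → x r ≤ γ * x r'

/-- The other assumptions on initialization and execution: initial stake, estimate of the initial
mining power, fluctuation of the mining power, participation of honest miners. -/
structure Setup.Standing (S : Setup P) (R : ℕ) (σ γ α₀ ε : ℝ) : Prop where
  init_stake : S.betaS ≤ 1 / 2 - σ
  init_work_lower : S.h 1 / ((1 + ε) * γ ^ 2) ≤ S.hEst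
  init_work_upper : S.hEst ≤ γ ^ 2 * S.h 1 / ((1 - ε) * α₀)
  respecting_h : Respecting γ (2 * R) S.h
  respecting_n : Respecting γ (2 * R) S.n
  participation : ∀ r, 1 ≤ r → α₀ * S.n r ≤ S.h r

end Resources

/-! ### Blocks and chains -/

/-- A main-chain (PoS) block. The PoW blocks that it references are given by their positions in
the table of all PoW blocks. The link to the parent is given by the position in a chain. -/
structure Block (P : Type) where
  slot : ℕ
  issuer : P
  pows : List ℕ

/-- A chain, oldest block first; the genesis block is left implicit, so `[]` is the chain that
consists of the genesis block. -/
abbrev Chain (P : Type) := List (Block P)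

/-- A PoW (endorser) block: its miner, its claimed slot, the main chain that ends in the confirmed
block it refers to, and the target for which it was mined. -/
structure PowBlock (P : Type) where
  miner : P
  slot : ℕ
  ref : Chain P
  target : ℝ

/-- Timestamp of the head of a chain. -/
def headSlot {P : Type} (C : Chain P) : ℕ := (C.getLast?.map Block.slot).getD 0

/-- At slot `r`, remove the blocks with timestamps in the last `ℓ` slots `r - ℓ + 1, …, r`. -/
def prune {P : Type} (ℓ r : ℕ) (C : Chain P) : Chain P :=
  C.takeWhile (fun b => decide (b.slot + ℓ ≤ r))

/-- The epoch `e` of slot `r`: epoch `e` consists of the slots `(e - 1) R + 1, …, e R`. -/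
def epoch (R r : ℕ) : ℕ := (r - 1) / R + 1

/-- The PoW blocks from the table `W` that are referenced by blocks of `C` with timestamps in
`(a, b]`. -/
def powsIn {P : Type} (W : List (PowBlock P)) (C : Chain P) (a b : ℕ) : List (PowBlock P) :=
  (C.filter (fun B => decide (a < B.slot ∧ B.slot ≤ b))).flatMap
    (fun B => B.pows.filterMap (fun i => W[i]?))

/-- Total difficulty of a list of PoW blocks. -/
def difficulty {P : Type} (L : List (PowBlock P)) : ℝ := (L.map (fun w => 1 / w.target)).sum

section Protocol

variable {P : Type} [Fintype P]

/-- The mining target of an epoch according to the chain `C`. Hash values are scaled to `[0, 1]`.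
In epoch 1 the target comes from the genesis block; later it is `fw` times the number of slots
in `((e - 2) R - κ, (e - 1) R - κ]` divided by the total difficulty of the PoW blocks referenced
there. It is left unchanged should there be no such PoW block. -/
def target (Q : Params) (S : Setup P) (W : List (PowBlock P)) (C : Chain P) : ℕ → ℝ
  | 0 => Q.fw / S.hEst
  | 1 => Q.fw / S.hEst
  | e + 2 =>
      let a := e * Q.R - Q.κ
      let b := (e + 1) * Q.R - Q.κ
      let D := difficulty (powsIn W C a b)
      if D = 0 then target Q S W C (e + 1) else Q.fw * ((b - a : ℕ) : ℝ) / D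

/-- Share of party `i` in the actual stake. -/
def stakeShare (S : Setup P) (i : P) : ℝ := S.stake i / ∑ j, S.stake j

open Classical in
/-- Share of party `i` in the difficulty of the PoW blocks referenced by `C` in epoch `e`. -/
def workShare (Q : Params) (W : List (PowBlock P)) (C : Chain P) (e : ℕ) (i : P) : ℝ :=
  let L := powsIn W C ((e - 1) * Q.R) (e * Q.R)
  difficulty (L.filter (fun w => decide (w.miner = i))) / difficulty L

/-- Relative virtual stake of party `i` in epoch `e` according to the chain `C`: the initial stake
in epochs 1 and 2, and from then on the combination, with weights `1 - ω` and `ω`, of actual stake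
and of the work stake earned in epoch `e - 2`. (If no PoW block was referenced there is no
work stake, and only the actual stake counts.) -/
def virtualStake (Q : Params) (S : Setup P) (W : List (PowBlock P)) (C : Chain P) (e : ℕ)
    (i : P) : ℝ :=
  if e ≤ 2 ∨ difficulty (powsIn W C ((e - 3) * Q.R) ((e - 2) * Q.R)) = 0 then stakeShare S i
  else (1 - Q.ω) * stakeShare S i + Q.ω * workShare Q W C (e - 2) i

/-- Virtual stake of all corrupted parties together. -/
def advVirtualStake (Q : Params) (S : Setup P) (W : List (PowBlock P)) (C : Chain P) (e : ℕ) :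
    ℝ :=
  ∑ i ∈ S.corrupt, virtualStake Q S W C e i

/-- The probability `φ_f(α) = 1 - (1 - f) ^ α` to be elected with relative virtual stake `α`. -/
def phi (f α : ℝ) : ℝ := 1 - (1 - f) ^ α

end Protocol

/-! ### Randomness -/

/-- The random values of an execution: for every slot and party, one value for the main-chain
lottery (`false`) and one for the hash query of the party (`true`). -/
abbrev Coins (P : Type) := ℕ × P × Bool → unitInterval

/-- All random values are independent and uniform on `[0, 1]`. -/
def coinLaw (P : Type) : MeasureTheory.Measure (Coins P) :=
  MeasureTheory.Measure.infinitePi (fun _ => MeasureTheory.volume)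

section Execution

variable {P : Type} [Fintype P]

/-- With the chain `C` as parent, party `i` is elected to issue a block in slot `r`. -/
def Elected (Q : Params) (S : Setup P) (x : Coins P) (W : List (PowBlock P)) (C : Chain P)
    (r : ℕ) (i : P) : Prop :=
  (x (r, i, false) : ℝ) < phi Q.f (virtualStake Q S W C (epoch Q.R r) i)

/-- The PoW block number `j` of the table `W` may be referenced by a block of slot `r` that
extends `C`: it refers to a confirmed block that lies on `C`, is older than its claimed slot and is recent,
it was mined for the right target, and it is not yet referenced. -/
def PowOK (Q : Params) (S : Setup P) (W : List (PowBlock P)) (C : Chain P) (r j : ℕ) : Prop :=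
  ∃ w, W[j]? = some w ∧ headSlot w.ref < w.slot ∧ w.slot < r ∧ w.ref <+: C ∧
    r ≤ headSlot w.ref + Q.slRe ∧
    w.target = target Q S W C (epoch Q.R w.slot) ∧ ∀ B ∈ C, j ∉ B.pows

/-- The state after some slot. -/
structure State (P : Type) where
  /-- all chains that exist -/
  chains : Set (Chain P)
  /-- the chains known to all honest parties -/
  pub : Set (Chain P)
  /-- the table of all PoW blocks found so far; it only grows at its end -/
  pows : List (PowBlock P)
  /-- (positions of) the PoW blocks known to all honest parties -/
  pubPows : Set ℕ
  /-- the chain adopted by each honest party -/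
  cur : P → Chain P

/-- The state before slot 1. -/
def genesis (P : Type) : State P where
  chains := {[]}
  pub := {[]}
  pows := []
  pubPows := ∅
  cur := fun _ => []

/-- What the adversary does in a slot: for every honest party, the chains delivered to it right
away; the PoW blocks that are released; the blocks that it tries to append to existing
chains, as triples (parent chain, issuer, referenced PoW blocks); for every corrupted miner, the
claimed slot and the chain that ends in the confirmed block its hash query refers to. -/
structure Action (P : Type) where
  deliver : P → Set (Chain P)
  release : Set ℕ
  propose : Set (Chain P × P × List ℕ)
  query : P → ℕ × Chain P

/-- The adversary acts in slot `r` on the basis of the state after slot `r - 1`. In particular it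
does not know the random values of the current and of later slots. -/
abbrev Adversary (P : Type) := ℕ → State P → Action P

/-- The chains in the view of the honest party `i` in a slot. -/
def view (st : State P) (a : Action P) (i : P) : Set (Chain P) :=
  st.pub ∪ (a.deliver i ∩ st.chains)

/-- `C'` forks from `C` by at most `k` blocks: at most `k` blocks of `C` would be discarded. -/
def ForksAtMost (k : ℕ) (C C' : Chain P) : Prop :=
  ∃ D : Chain P, D <+: C ∧ D <+: C' ∧ C.length ≤ D.length + k

/-- The chains held by the honest party `i`, i.e. the best chains in its view according to
`maxvalid-mc`: the longest ones among those that fork by at most `k` blocks from its current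
chain. -/
def held (Q : Params) (st : State P) (a : Action P) (i : P) : Set (Chain P) :=
  {C | C ∈ view st a i ∧ ForksAtMost Q.k (st.cur i) C ∧
    ∀ C' ∈ view st a i, ForksAtMost Q.k (st.cur i) C' → C'.length ≤ C.length}

open Classical in
/-- The chain adopted by the honest party `i`: the current one if it is among the best chains,
otherwise one of the best chains. -/
def adopt (Q : Params) (st : State P) (a : Action P) (i : P) : Chain P :=
  if st.cur i ∈ held Q st a i then st.cur i
  else if h : (held Q st a i).Nonempty then h.some else st.cur i

open Classical in
/-- An honest party that is elected in slot `r` extends its chain `C` by this block, which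
references all PoW blocks that it knows and that may be referenced. -/
def honestBlock (Q : Params) (S : Setup P) (st : State P) (r : ℕ) (C : Chain P) (i : P) :
    Block P where
  slot := r
  issuer := i
  pows := (List.range st.pows.length).filter
    (fun j => decide (j ∈ st.pubPows ∧ PowOK Q S st.pows C r j))

open Classical in
/-- The chain of the honest party `i` at the end of slot `r`. -/
def honestChain (Q : Params) (S : Setup P) (x : Coins P) (st : State P) (r : ℕ) (a : Action P)
    (i : P) : Chain P :=
  let C := adopt Q st a i
  if Elected Q S x st.pows C r i then C ++ [honestBlock Q S st r C i] else C

/-- The chains that the adversary creates in slot `r`: a corrupted party that is elected for the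
parent chain appends a valid block. It may do so for several parent chains. -/
def advChains (Q : Params) (S : Setup P) (x : Coins P) (st : State P) (r : ℕ) (a : Action P) :
    Set (Chain P) :=
  {C' | ∃ C i L, (C, i, L) ∈ a.propose ∧ C ∈ st.chains ∧ i ∈ S.corrupt ∧ headSlot C < r ∧
    Elected Q S x st.pows C r i ∧ L.Nodup ∧ (∀ j ∈ L, PowOK Q S st.pows C r j) ∧
    C' = C ++ [⟨r, i, L⟩]}

/-- The PoW block that the query of party `i` in slot `r` is about. Honest miners refer to the
last confirmed block of their chain. -/
def powCandidate (Q : Params) (S : Setup P) (st : State P) (r : ℕ) (a : Action P) (i : P) :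
    PowBlock P :=
  open Classical in
  let s := if i ∈ S.corrupt then (a.query i).1 else r
  let C := if i ∈ S.corrupt then (a.query i).2 else prune Q.κ r (adopt Q st a i)
  ⟨i, s, C, target Q S st.pows C (epoch Q.R s)⟩

open Classical in
/-- The PoW blocks found in slot `r`. Every active miner makes one query, and is successful if
the hash value is below the target. -/
def newPows (Q : Params) (S : Setup P) (x : Coins P) (st : State P) (r : ℕ) (a : Action P) :
    List (PowBlock P) :=
  ((Finset.univ : Finset P).toList.filter (fun i =>
      decide (i ∈ S.honestMiners r ∪ S.corruptMiners r ∧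
        (x (r, i, true) : ℝ) < (powCandidate Q S st r a i).target))).map
    (powCandidate Q S st r a)

/-- One slot of the execution, in the lock-step synchronous model: what an honest party creates
or receives in a slot is known to all honest parties in the next slot. -/
def step (Q : Params) (S : Setup P) (x : Coins P) (st : State P) (r : ℕ) (a : Action P) :
    State P :=
  let honestNew := {C | ∃ i, i ∉ S.corrupt ∧ C = honestChain Q S x st r a i}
  let delivered := {C | ∃ i, i ∉ S.corrupt ∧ C ∈ view st a i}
  let W := st.pows ++ newPows Q S x st r a
  { chains := st.chains ∪ honestNew ∪ advChains Q S x st r a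
    pub := st.pub ∪ honestNew ∪ delivered
    pows := W
    pubPows := st.pubPows ∪ {j | j < st.pows.length ∧ j ∈ a.release} ∪
      {j | st.pows.length ≤ j ∧ ∃ w, W[j]? = some w ∧ w.miner ∉ S.corrupt}
    cur := honestChain Q S x st r a }

/-- The state after `n` slots, from the state `st₀` after slot `t₀`. -/
def run (Q : Params) (S : Setup P) (A : Adversary P) (t₀ : ℕ) (st₀ : State P) (x : Coins P) :
    ℕ → State P
  | 0 => st₀
  | n + 1 =>
      let st := run Q S A t₀ st₀ x n
      step Q S x st (t₀ + n + 1) (A (t₀ + n + 1) st)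

/-- `C` is held by the honest party `i` at slot `t₀ + n + 1` in the execution from `st₀`. -/
def HeldAt (Q : Params) (S : Setup P) (A : Adversary P) (t₀ : ℕ) (st₀ : State P) (x : Coins P)
    (n : ℕ) (i : P) (C : Chain P) : Prop :=
  i ∉ S.corrupt ∧
    C ∈ held Q (run Q S A t₀ st₀ x n) (A (t₀ + n + 1) (run Q S A t₀ st₀ x n)) i

/-- Common prefix with parameter `ℓ` in the `T` slots `t₀ + 1, …, t₀ + T`: whenever honest parties
hold `C₁`, `C₂` at slots `r₁ ≤ r₂`, then `C₁` pruned by the last `ℓ` slots is a prefix of `C₂`. -/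
def CommonPrefix (Q : Params) (S : Setup P) (A : Adversary P) (t₀ : ℕ) (st₀ : State P)
    (x : Coins P) (ℓ T : ℕ) : Prop :=
  ∀ n₁ n₂ : ℕ, n₁ ≤ n₂ → n₂ < T → ∀ (i j : P) (C₁ C₂ : Chain P),
    HeldAt Q S A t₀ st₀ x n₁ i C₁ → HeldAt Q S A t₀ st₀ x n₂ j C₂ →
      prune ℓ (t₀ + n₁ + 1) C₁ <+: C₂

/-- `st` is a state after slot `t` in which all honest parties agree on the chain `C₀`; the
adversary may have withheld any other chains and PoW blocks. -/
structure Agreement (S : Setup P) (t : ℕ) (st : State P) (C₀ : Chain P) : Prop where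
  cur_eq : ∀ i, i ∉ S.corrupt → st.cur i = C₀
  chains_finite : st.chains.Finite
  mem_chains : C₀ ∈ st.chains
  mem_pub : C₀ ∈ st.pub
  pub_chains : st.pub ⊆ st.chains
  pub_shorter : ∀ C ∈ st.pub, C ≠ C₀ → C.length < C₀.length
  slots_sorted : ∀ C ∈ st.chains, C.Pairwise (fun B B' => B.slot < B'.slot)
  slots_pos : ∀ C ∈ st.chains, ∀ B ∈ C, 1 ≤ B.slot
  slots_le : ∀ C ∈ st.chains, ∀ B ∈ C, B.slot ≤ t
  pows_lt : ∀ C ∈ st.chains, ∀ B ∈ C, ∀ j ∈ B.pows, j < st.pows.length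
  target_pos : ∀ w ∈ st.pows, 0 < w.target

/-- The probability that the adversary violates common prefix with parameter `ℓ` within `T` slots,
when the execution continues from the state `st₀` after slot `t₀` with fresh randomness. -/
def cpFailure (Q : Params) (S : Setup P) (A : Adversary P) (t₀ : ℕ) (st₀ : State P) (ℓ T : ℕ) :
    ENNReal :=
  coinLaw P {x | ¬ CommonPrefix Q S A t₀ st₀ x ℓ T}

end Execution

end

end Minotaur

namespace Minotaur

open Finset

/-! ### Weights of 0-1-patterns -/

/-! The proof is a private chain attack with a change-of-measure estimate of its success
probability.

Let honest parties agree on `C₀` at the start of an epoch. For `N = ℓ + s` slots, with `s` depending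
only on `f`, the adversary withholds a chain of its own on top of `C₀`. In the lock-step model the
longest public chains grow by exactly one block per slot with an honest election, and the private
chain can grow by one per slot with a corrupted election. Virtual stake depends only on blocks of
earlier epochs, so the election thresholds are the same on both branches and constant during the
attack. Suppose that the corrupted side has at least as many hit slots as the honest one, that the
honest side has at most `ℓ ≤ k` of them, and that one lies among the first `s + 1` slots
(`attackPatterns`). Then in slot `t + N + 1` a private chain of exactly the public length is
delivered. The tie makes one honest party hold both chains, yet the first honest block is old enough
to survive pruning and is missing from the private chain (`attackInvariant_run`,
`not_commonPrefix_of_attackPattern`).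

A side with total virtual stake `α` has no hit in a slot with probability `(1 - f) ^ α`,
independently over slots and sides (`coinLaw_hitPattern_eq`, `prod_one_sub_phi`). At `α = 1 / 2` on
both sides, symmetry gives probability at least `1 / 2` for the comparison of hits, and the two
remaining conditions cost at most `1 / 8` each (`quarter_le_sum_attackPatterns`). For stakes `1 / 2
± d`, Cauchy-Schwarz bounds the square of the symmetric probability by the true one times the second
moment of the likelihood ratio. Each of the at most `4 * ℓ` coordinates contributes a factor at most
`exp (256 * d ^ 2)`, with a constant that does not depend on `f` (`exists_rpow_close`,
`second_moment_le`). As `d ^ 2 * ℓ ≤ 1`, the success probability is at least `exp (-1024) / 16`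
(`exists_attack_bound`). -/

/-- Weight of a Boolean outcome that is `false` with probability `y`. -/
def boolWeight (y : ℝ) (b : Bool) : ℝ := if b then 1 - y else y

/-- Weight of a pattern of independent Boolean outcomes, `y i` being the probability of `false`
at position `i`. -/
def patternWeight {ι : Type*} [Fintype ι] (y : ι → ℝ) (ω : ι → Bool) : ℝ :=
  ∏ i, boolWeight (y i) (ω i)

lemma boolWeight_pos {y : ℝ} (h0 : 0 < y) (h1 : y < 1) (b : Bool) : 0 < boolWeight y b := by
  cases b <;> simp [boolWeight, h0, h1]

section Patterns

variable {ι : Type*} [Fintype ι]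

lemma patternWeight_pos {y : ι → ℝ} (h0 : ∀ i, 0 < y i) (h1 : ∀ i, y i < 1) (ω : ι → Bool) :
    0 < patternWeight y ω :=
  prod_pos fun i _ => boolWeight_pos (h0 i) (h1 i) _

variable [DecidableEq ι]

/-- Independence: the expectation of a product of functions of single coordinates factorizes. -/
lemma sum_patternWeight_mul_prod (y : ι → ℝ) (g : ι → Bool → ℝ) :
    ∑ ω, patternWeight y ω * ∏ i, g i (ω i) =
      ∏ i, ((1 - y i) * g i true + y i * g i false) := by
  have h := Fintype.prod_sum (fun (i : ι) (b : Bool) => boolWeight (y i) b * g i b)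
  simp only [Fintype.sum_bool, prod_mul_distrib] at h
  simpa [boolWeight, patternWeight] using h.symm

lemma sum_patternWeight (y : ι → ℝ) : ∑ ω, patternWeight y ω = 1 := by
  simpa using sum_patternWeight_mul_prod y (fun _ _ => 1)

/-- Markov's inequality for a product test function, whose expectation factorizes. It serves as a
union-free exact bound and as a Chernoff bound below. -/
lemma sum_patternWeight_le_of_prod_bound {y : ι → ℝ} (h0 : ∀ i, 0 < y i) (h1 : ∀ i, y i < 1)
    (E : Finset (ι → Bool)) (g : ι → Bool → ℝ) (hg : ∀ i b, 0 ≤ g i b) (M : ℝ)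
    (hE : ∀ ω ∈ E, 1 ≤ M * ∏ i, g i (ω i)) (hM : 0 ≤ M) :
    ∑ ω ∈ E, patternWeight y ω ≤ M * ∏ i, ((1 - y i) * g i true + y i * g i false) := by
  rw [← sum_patternWeight_mul_prod, mul_sum]
  refine (sum_le_sum fun ω hω => ?_).trans (sum_le_univ_sum_of_nonneg (fun ω => ?_))
  · have := mul_le_mul_of_nonneg_left (hE ω hω) (patternWeight_pos h0 h1 ω).le
    linarith
  · exact mul_nonneg hM (mul_nonneg (patternWeight_pos h0 h1 ω).le
      (prod_nonneg fun i _ => hg i _))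

/-- Change of measure: Cauchy-Schwarz against the likelihood ratio. -/
lemma sq_sum_patternWeight_le {y q : ι → ℝ} (h0 : ∀ i, 0 < y i) (h1 : ∀ i, y i < 1)
    (E : Finset (ι → Bool)) :
    (∑ ω ∈ E, patternWeight q ω) ^ 2 ≤
      (∑ ω ∈ E, patternWeight y ω) * ∏ i, ((1 - q i) ^ 2 / (1 - y i) + q i ^ 2 / y i) := by
  rcases E.eq_empty_or_nonempty with rfl | hne
  · simp
  have hpos : 0 < ∑ ω ∈ E, patternWeight y ω :=
    sum_pos (fun ω _ => patternWeight_pos h0 h1 ω) hne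
  have h := sq_sum_div_le_sum_sq_div E (patternWeight q) (g := patternWeight y)
    (fun ω _ => patternWeight_pos h0 h1 ω)
  rw [div_le_iff₀ hpos] at h
  refine h.trans ?_
  rw [mul_comm]
  refine mul_le_mul_of_nonneg_left ?_ hpos.le
  -- Extending the sum from `E` to all patterns only adds nonnegative terms, and the full second
  -- moment is a product over coordinates.
  refine (sum_le_univ_sum_of_nonneg (fun ω => ?_)).trans (le_of_eq ?_)
  · exact div_nonneg (sq_nonneg _) (patternWeight_pos h0 h1 ω).le
  · have h := Fintype.prod_sum
      (fun (i : ι) (b : Bool) => boolWeight (q i) b ^ 2 / boolWeight (y i) b)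
    simp only [Fintype.sum_bool, prod_div_distrib, prod_pow] at h
    simpa [boolWeight, patternWeight] using h.symm

end Patterns

/-! ### The patterns for which the attack succeeds -/

/-- The number of slots with a hit on one side (`true`: honest, `false`: corrupted). -/
def hits {N : ℕ} (ω : Fin N × Bool → Bool) (side : Bool) : ℕ :=
  (univ.filter fun n => ω (n, side) = true).card

/-- The corrupted side has at least as many hits as the honest one, and the honest side has a hit
in the first `s + 1` slots, and at most `ℓ` hits altogether. -/
def attackPatterns (N s ℓ : ℕ) : Finset (Fin N × Bool → Bool) :=
  univ.filter fun ω => hits ω true ≤ hits ω false ∧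
    (∃ n : Fin N, n.1 ≤ s ∧ ω (n, true) = true) ∧ hits ω true ≤ ℓ

lemma patternWeight_swap {N : ℕ} (q : ℝ) (ω : Fin N × Bool → Bool) :
    patternWeight (fun _ => q) (fun p : Fin N × Bool => ω (p.1, !p.2)) = patternWeight (fun _ => q) ω := by
  unfold patternWeight
  simp only [Fintype.prod_prod_type, Fintype.prod_bool, Bool.not_true, Bool.not_false]
  exact prod_congr rfl fun _ _ => mul_comm _ _

/-- Exchanging the two sides preserves the weight when all coordinates have the same parameter, and
it maps the complement of the event into the event. -/
lemma half_le_sum_hits_le {N : ℕ} {q : ℝ} (h0 : 0 < q) (h1 : q < 1) :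
    1 / 2 ≤ ∑ ω : Fin N × Bool → Bool with hits ω true ≤ hits ω false,
      patternWeight (fun _ => q) ω := by
  have hsum := sum_patternWeight (fun _ : Fin N × Bool => q)
  rw [← sum_filter_add_sum_filter_not univ (fun ω => hits ω true ≤ hits ω false)] at hsum
  have hle : ∑ ω : Fin N × Bool → Bool with ¬ hits ω true ≤ hits ω false,
      patternWeight (fun _ => q) ω ≤
      ∑ ω : Fin N × Bool → Bool with hits ω true ≤ hits ω false,
      patternWeight (fun _ => q) ω := by
    let sw : (Fin N × Bool → Bool) → (Fin N × Bool → Bool) := fun ω p => ω (p.1, !p.2)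
    have hsw : ∀ ω, sw (sw ω) = ω := fun ω => by ext p; simp [sw]
    rw [← sum_nbij' (s := univ.filter fun ω => ¬ hits (sw ω) true ≤ hits (sw ω) false)
      (f := patternWeight (fun _ => q)) sw sw]
    · refine sum_le_sum_of_subset_of_nonneg (fun ω hω => ?_)
        (fun ω _ _ => (patternWeight_pos (fun _ => h0) (fun _ => h1) ω).le)
      have h1 : hits (sw ω) true = hits ω false := rfl
      have h2 : hits (sw ω) false = hits ω true := rfl
      simp only [mem_filter, mem_univ, true_and, h1, h2, not_le] at hω ⊢
      exact hω.le
    · intro ω hω; simpa using hω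
    · intro ω hω; simpa [hsw] using hω
    · intro ω _; exact hsw ω
    · intro ω _; exact hsw ω
    · intro ω _; exact (patternWeight_swap q ω).symm
  linarith

lemma sum_no_early_hit_le {N s : ℕ} (hs : s < N) {q : ℝ} (h0 : 0 < q) (h1 : q < 1) :
    ∑ ω : Fin N × Bool → Bool with ¬ ∃ n : Fin N, n.1 ≤ s ∧ ω (n, true) = true,
      patternWeight (fun _ => q) ω ≤ q ^ (s + 1) := by
  have h := sum_patternWeight_le_of_prod_bound (ι := Fin N × Bool) (y := fun _ => q)
    (fun _ => h0) (fun _ => h1)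
    (univ.filter fun ω => ¬ ∃ n : Fin N, n.1 ≤ s ∧ ω (n, true) = true)
    -- The product of these factors is the indicator of the event: a factor vanishes exactly at an
    -- early honest hit.
    (fun p b => if p.1.1 ≤ s ∧ p.2 = true ∧ b = true then 0 else 1)
    (fun p b => by split_ifs <;> norm_num) 1 ?_ zero_le_one
  · refine h.trans (le_of_eq ?_)
    simp only [Fintype.prod_prod_type, Fintype.prod_bool, one_mul]
    simp only [and_true, Bool.false_eq_true, and_false, if_false,
      mul_one, sub_add_cancel]
    have : ∀ n : Fin N, (1 - q) * (if n.1 ≤ s then (0 : ℝ) else 1) + q =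
        if n.1 ≤ s then q else 1 := fun n => by split_ifs <;> ring
    simp only [this]
    rw [Fin.prod_univ_eq_prod_range (fun n => if n ≤ s then q else 1) N, prod_ite, prod_const,
      prod_const_one, mul_one]
    congr 1
    have : (range N).filter (fun n => n ≤ s) = range (s + 1) := by
      ext n; simp only [mem_filter, mem_range]; omega
    rw [this, card_range]
  · intro ω hω
    simp only [mem_filter, mem_univ, true_and, not_exists, not_and] at hω
    rw [one_mul, prod_eq_one]
    rintro ⟨n, b⟩ _
    rw [if_neg]
    rintro ⟨h, h', h''⟩
    simp only at h h' h''
    subst h'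
    exact hω n h h''

/-- Chernoff bound: more than `ℓ` hits in `ℓ + s` slots leave at most `s` misses, so weighting each
miss by `1 / 2` gives at least `2⁻ˢ`, while the mean weight per slot is `1 - q / 2`. -/
lemma sum_many_hits_le {ℓ s : ℕ} {q : ℝ} (h0 : 0 < q) (h1 : q < 1) :
    ∑ ω : Fin (ℓ + s) × Bool → Bool with ¬ hits ω true ≤ ℓ, patternWeight (fun _ => q) ω ≤
      2 ^ s * (1 - q / 2) ^ ℓ := by
  have h := sum_patternWeight_le_of_prod_bound (ι := Fin (ℓ + s) × Bool) (y := fun _ => q)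
    (fun _ => h0) (fun _ => h1) (univ.filter fun ω => ¬ hits ω true ≤ ℓ)
    (fun p b => if p.2 = true ∧ b = false then 1 / 2 else 1)
    (fun p b => by split_ifs <;> norm_num) (2 ^ s) ?_ (by positivity)
  · refine h.trans ?_
    simp only [Fintype.prod_prod_type, Fintype.prod_bool]
    simp only [and_true, Bool.false_eq_true, Bool.true_eq_false, and_false,
      if_false, if_true, mul_one, sub_add_cancel, prod_const, card_univ, Fintype.card_fin]
    have e : 1 - q + q * (1 / 2) = 1 - q / 2 := by ring
    rw [e]
    refine mul_le_mul_of_nonneg_left ?_ (by positivity)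
    exact pow_le_pow_of_le_one (by linarith) (by linarith) (by omega)
  · intro ω hω
    simp only [mem_filter, mem_univ, true_and, not_le] at hω
    simp only [Fintype.prod_prod_type, Fintype.prod_bool, true_and, Bool.false_eq_true,
      false_and, if_false, mul_one]
    rw [prod_ite, prod_const, prod_const_one, mul_one]
    have hc : (univ.filter fun n : Fin (ℓ + s) => ω (n, true) = false).card ≤ s := by
      have := card_filter_add_card_filter_not (s := (univ : Finset (Fin (ℓ + s))))
        (fun n => ω (n, true) = true)
      simp only [Bool.not_eq_true, card_univ, Fintype.card_fin] at this
      simp only [hits] at hω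
      omega
    calc (1 : ℝ) = 2 ^ s * (1 / 2) ^ s := by rw [← mul_pow]; norm_num
      _ ≤ _ := mul_le_mul_of_nonneg_left
        (pow_le_pow_of_le_one (by norm_num) (by norm_num) hc) (by positivity)

lemma quarter_le_sum_attackPatterns {ℓ s : ℕ} {q : ℝ} (h0 : 0 < q) (h1 : q < 1) (hℓ : 0 < ℓ)
    (hs : q ^ (s + 1) ≤ 1 / 8) (hℓs : 2 ^ s * (1 - q / 2) ^ ℓ ≤ 1 / 8) :
    1 / 4 ≤ ∑ ω ∈ attackPatterns (ℓ + s) s ℓ, patternWeight (fun _ => q) ω := by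
  have a := half_le_sum_hits_le (N := ℓ + s) h0 h1
  have b := sum_no_early_hit_le (N := ℓ + s) (s := s) (by omega) h0 h1
  have c := sum_many_hits_le (ℓ := ℓ) (s := s) h0 h1
  have hsub : (univ.filter fun ω : Fin (ℓ + s) × Bool → Bool => hits ω true ≤ hits ω false) ⊆
      attackPatterns (ℓ + s) s ℓ ∪
      ((univ.filter fun ω => ¬ ∃ n : Fin (ℓ + s), n.1 ≤ s ∧ ω (n, true) = true) ∪
      univ.filter fun ω => ¬ hits ω true ≤ ℓ) := by
    intro ω hω
    simp only [attackPatterns, mem_union, mem_filter, mem_univ, true_and] at hω ⊢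
    by_cases h : ∃ n : Fin (ℓ + s), n.1 ≤ s ∧ ω (n, true) = true
    · exact (le_or_gt (hits ω true) ℓ).imp (fun h' => ⟨hω, h, h'⟩) fun h' => .inr h'.not_ge
    · exact .inr (.inl h)
  have hn : ∀ ω : Fin (ℓ + s) × Bool → Bool, 0 ≤ patternWeight (fun _ => q) ω :=
    fun ω => (patternWeight_pos (fun _ => h0) (fun _ => h1) ω).le
  have hu : ∀ A B : Finset (Fin (ℓ + s) × Bool → Bool),
      ∑ ω ∈ A ∪ B, patternWeight (fun _ => q) ω ≤
      ∑ ω ∈ A, patternWeight (fun _ => q) ω + ∑ ω ∈ B, patternWeight (fun _ => q) ω := by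
    intro A B
    have := sum_union_inter (s₁ := A) (s₂ := B) (f := patternWeight (fun _ => q))
    have h' : 0 ≤ ∑ ω ∈ A ∩ B, patternWeight (fun _ => q) ω := sum_nonneg fun ω _ => hn ω
    linarith
  have d := (sum_le_sum_of_subset_of_nonneg hsub fun ω _ _ => hn ω).trans (hu _ _)
  have e := hu (univ.filter fun ω => ¬ ∃ n : Fin (ℓ + s), n.1 ≤ s ∧ ω (n, true) = true)
    (univ.filter fun ω => ¬ hits ω true ≤ ℓ)
  linarith

/-! ### Election probabilities near one half -/

/-- The ratio of the squared shift to the Bernoulli variance `y * (1 - y)` must be bounded uniformly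
in `f`; only the admissible range `η` may depend on `f`. With `u` the fourth root of `1 - f` and `Λ
= -log (1 - f)`, the inequality `log (1 / u) ≤ 1 / u - 1` gives `Λ * u ≤ 4 * (1 - u)`. This controls
`Λ ^ 2 * u ^ 2` by `1 - u ^ 2`, both for `f` near 0 and for `f` near 1. -/
lemma exists_rpow_close {f : ℝ} (hf0 : 0 < f) (hf1 : f < 1) :
    ∃ η : ℝ, 0 < η ∧ ∀ d : ℝ, |d| ≤ η →
      0 < (1 - f) ^ (1 / 2 + d) ∧ (1 - f) ^ (1 / 2 + d) < 1 ∧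
      ((1 - f) ^ (1 / 2 : ℝ) - (1 - f) ^ (1 / 2 + d)) ^ 2 ≤
        256 * d ^ 2 * ((1 - f) ^ (1 / 2 + d) * (1 - (1 - f) ^ (1 / 2 + d))) := by
  have hg : 0 < 1 - f := by linarith
  obtain ⟨u, hu⟩ : ∃ u, u = (1 - f) ^ (1 / 4 : ℝ) := ⟨_, rfl⟩
  have hu0 : 0 < u := hu ▸ Real.rpow_pos_of_pos hg _
  have hu1 : u < 1 := hu ▸ Real.rpow_lt_one hg.le (by linarith) (by norm_num)
  have hq : (1 - f) ^ (1 / 2 : ℝ) = u ^ 2 := by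
    rw [hu, ← Real.rpow_natCast, ← Real.rpow_mul hg.le]; norm_num
  have hlogu : Real.log u = 1 / 4 * Real.log (1 - f) := by rw [hu, Real.log_rpow hg]
  obtain ⟨Λ, hΛ⟩ : ∃ Λ, Λ = -Real.log (1 - f) := ⟨_, rfl⟩
  have hΛ0 : 0 < Λ := by rw [hΛ]; have := Real.log_neg hg (by linarith); linarith
  have hΛu : Λ * u ≤ 4 * (1 - u) := by
    have h := Real.log_le_sub_one_of_pos (inv_pos.mpr hu0)
    rw [Real.log_inv] at h
    have h2 : Λ ≤ 4 * (u⁻¹ - 1) := by rw [hΛ]; linarith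
    calc Λ * u ≤ 4 * (u⁻¹ - 1) * u := mul_le_mul_of_nonneg_right h2 hu0.le
      _ = 4 * (1 - u) := by field_simp
  have hq1 : u ^ 2 < 1 := by nlinarith
  -- The first bound keeps `y` at least half of `q = u ^ 2`, the second keeps `1 - y` at least half
  -- of `1 - q`.
  refine ⟨min (1 / (4 * Λ)) ((1 - u ^ 2) / (4 * Λ)), by
    apply lt_min <;> apply div_pos <;> linarith, fun d hd => ?_⟩
  have hd1 : Λ * |d| ≤ 1 / 4 := by
    have := (le_div_iff₀ (by positivity)).mp (hd.trans (min_le_left _ _)); linarith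
  have hd2 : Λ * |d| ≤ (1 - u ^ 2) / 4 := by
    have := (le_div_iff₀ (by positivity)).mp (hd.trans (min_le_right _ _)); linarith
  have hy : (1 - f) ^ (1 / 2 + d) = u ^ 2 * Real.exp (-(Λ * d)) := by
    rw [Real.rpow_add hg, hq, Real.rpow_def_of_pos hg d, hΛ]; congr 2; ring
  have habs : |-(Λ * d)| = Λ * |d| := by rw [abs_neg, abs_mul, abs_of_pos hΛ0]
  have hexp := Real.abs_exp_sub_one_le (x := -(Λ * d)) (by rw [habs]; linarith)
  rw [habs] at hexp
  obtain ⟨z, hz⟩ : ∃ z, z = Real.exp (-(Λ * d)) - 1 := ⟨_, rfl⟩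
  have hyz : (1 - f) ^ (1 / 2 + d) = u ^ 2 + u ^ 2 * z := by rw [hy, hz]; ring
  rw [← hz] at hexp
  have hz2 : z ^ 2 ≤ 4 * Λ ^ 2 * d ^ 2 := by
    have := pow_le_pow_left₀ (abs_nonneg z) hexp 2
    rw [sq_abs] at this
    calc z ^ 2 ≤ _ := this
      _ = 4 * Λ ^ 2 * |d| ^ 2 := by ring
      _ = _ := by rw [sq_abs]
  obtain ⟨hz3, hz4⟩ := abs_le.mp hexp
  have hq0 : 0 < u ^ 2 := by positivity
  rw [hq, hyz]
  have hylow : u ^ 2 / 2 ≤ u ^ 2 + u ^ 2 * z := by nlinarith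
  have hyhigh : (1 - u ^ 2) / 2 ≤ 1 - (u ^ 2 + u ^ 2 * z) := by nlinarith
  refine ⟨by linarith, by linarith, ?_⟩
  -- The constant is `256 = 4 * 16 * 4`: from `z ^ 2 ≤ 4 * Λ ^ 2 * d ^ 2`, from `Λ ^ 2 * u ^ 2 ≤ 16
  -- * (1 - u ^ 2)`, and from halving both factors of the variance.
  have hprod : u ^ 2 / 2 * ((1 - u ^ 2) / 2) ≤
      (u ^ 2 + u ^ 2 * z) * (1 - (u ^ 2 + u ^ 2 * z)) :=
    mul_le_mul hylow hyhigh (by linarith) (by linarith)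
  have hΛ2 : Λ ^ 2 * u ^ 2 ≤ 16 * (1 - u ^ 2) := by
    have := pow_le_pow_left₀ (by positivity) hΛu 2
    nlinarith
  have e1 : (u ^ 2 - (u ^ 2 + u ^ 2 * z)) ^ 2 ≤ u ^ 2 * u ^ 2 * (4 * Λ ^ 2 * d ^ 2) := by
    calc (u ^ 2 - (u ^ 2 + u ^ 2 * z)) ^ 2 = u ^ 2 * u ^ 2 * z ^ 2 := by ring
      _ ≤ _ := mul_le_mul_of_nonneg_left hz2 (by positivity)
  have e2 : u ^ 2 * u ^ 2 * (4 * Λ ^ 2 * d ^ 2) ≤ 4 * u ^ 2 * d ^ 2 * (16 * (1 - u ^ 2)) := by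
    calc u ^ 2 * u ^ 2 * (4 * Λ ^ 2 * d ^ 2) = 4 * u ^ 2 * d ^ 2 * (Λ ^ 2 * u ^ 2) := by ring
      _ ≤ _ := mul_le_mul_of_nonneg_left hΛ2 (by positivity)
  have e3 := mul_le_mul_of_nonneg_left hprod (by positivity : 0 ≤ 256 * d ^ 2)
  calc _ ≤ _ := e1
    _ ≤ _ := e2
    _ = 256 * d ^ 2 * (u ^ 2 / 2 * ((1 - u ^ 2) / 2)) := by ring
    _ ≤ _ := e3

/-- The left side is one plus the chi-square divergence of the two Bernoulli laws. -/
lemma second_moment_le {q y d : ℝ} (h0 : 0 < y) (h1 : y < 1)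
    (h : (q - y) ^ 2 ≤ 256 * d ^ 2 * (y * (1 - y))) :
    (1 - q) ^ 2 / (1 - y) + q ^ 2 / y ≤ Real.exp (256 * d ^ 2) := by
  have h1' : 0 < 1 - y := by linarith
  have e : (1 - q) ^ 2 / (1 - y) + q ^ 2 / y = 1 + (q - y) ^ 2 / (y * (1 - y)) := by
    field_simp; ring
  rw [e]
  have : (q - y) ^ 2 / (y * (1 - y)) ≤ 256 * d ^ 2 := (div_le_iff₀ (by positivity)).mpr h
  have := Real.add_one_le_exp (256 * d ^ 2)
  linarith

/-- For large `ℓ`, the attack succeeds with probability at least `exp (-1024) / 16` if the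
corrupted stake is at least `1 / 2 - 1 / √ℓ`. -/
lemma exists_attack_bound {f : ℝ} (hf0 : 0 < f) (hf1 : f < 1) :
    ∃ ℓ₀ s : ℕ, 4 ≤ ℓ₀ ∧ s < ℓ₀ ∧ ∀ (ℓ : ℕ) (d : ℝ), ℓ₀ ≤ ℓ → 0 ≤ d → d ≤ 1 / Real.sqrt ℓ →
      Real.exp (-1024) / 16 ≤ ∑ ω ∈ attackPatterns (ℓ + s) s ℓ,
        patternWeight (fun p => (1 - f) ^ (1 / 2 + if p.2 then d else -d)) ω := by
  obtain ⟨η, hη, hclose⟩ := exists_rpow_close hf0 hf1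
  have hg : 0 < 1 - f := by linarith
  obtain ⟨q, hq⟩ : ∃ q, q = (1 - f) ^ (1 / 2 : ℝ) := ⟨_, rfl⟩
  have hq0 : 0 < q := hq ▸ Real.rpow_pos_of_pos hg _
  have hq1 : q < 1 := hq ▸ Real.rpow_lt_one hg.le (by linarith) (by norm_num)
  rw [← hq] at hclose
  obtain ⟨s, hs⟩ := exists_pow_lt_of_lt_one (by norm_num : (0 : ℝ) < 1 / 8) hq1
  have hs' : q ^ (s + 1) ≤ 1 / 8 := by
    refine le_trans ?_ hs.le
    exact pow_le_pow_of_le_one hq0.le hq1.le (by omega)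
  obtain ⟨a, ha⟩ := exists_pow_lt_of_lt_one
    (by positivity : (0 : ℝ) < 1 / 8 / 2 ^ s) (by linarith : 1 - q / 2 < 1)
  obtain ⟨b, hb⟩ := exists_nat_gt ((1 / η) ^ 2)
  -- Here `a` makes many honest hits unlikely, `b` forces `d ≤ η`, the summand `s` gives `s < ℓ₀`,
  -- so that the attack lasts fewer than `2 * ℓ` slots, and `4` yields `1 / √ℓ ≤ 1 / 2`.
  refine ⟨4 + s + a + b, s, by omega, by omega, fun ℓ d hℓ hd0 hd => ?_⟩
  have hℓpos : (0 : ℝ) < ℓ := by exact_mod_cast (by omega : 0 < ℓ)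
  have hdη : d ≤ η := by
    refine hd.trans ?_
    rw [div_le_iff₀ (Real.sqrt_pos.mpr hℓpos), ← div_le_iff₀' hη]
    refine Real.le_sqrt_of_sq_le (hb.le.trans ?_)
    exact_mod_cast (by omega : b ≤ ℓ)
  have hdsq : d ^ 2 * ℓ ≤ 1 := by
    have := pow_le_pow_left₀ hd0 hd 2
    rw [div_pow, Real.sq_sqrt hℓpos.le, one_pow, le_div_iff₀ hℓpos] at this
    exact this
  have hcl : ∀ p : Fin (ℓ + s) × Bool, _ := fun p =>
    hclose (if p.2 then d else -d) (by split_ifs <;> simp [abs_of_nonneg hd0, hdη])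
  have hquarter := quarter_le_sum_attackPatterns (ℓ := ℓ) (s := s) hq0 hq1 (by omega) hs' (by
    have h1 : (1 - q / 2) ^ ℓ ≤ (1 - q / 2) ^ a :=
      pow_le_pow_of_le_one (by linarith) (by linarith) (by omega)
    have h2 := h1.trans ha.le
    rw [le_div_iff₀ (by positivity)] at h2
    linarith)
  have hCS := sq_sum_patternWeight_le (q := fun _ => q) (fun p => (hcl p).1)
    (fun p => (hcl p).2.1) (attackPatterns (ℓ + s) s ℓ)
  have hprod : ∏ p : Fin (ℓ + s) × Bool,
      ((1 - q) ^ 2 / (1 - (1 - f) ^ (1 / 2 + if p.2 then d else -d)) +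
        q ^ 2 / (1 - f) ^ (1 / 2 + if p.2 then d else -d)) ≤ Real.exp 1024 := by
    have hle : ∀ p : Fin (ℓ + s) × Bool,
        (1 - q) ^ 2 / (1 - (1 - f) ^ (1 / 2 + if p.2 then d else -d)) +
        q ^ 2 / (1 - f) ^ (1 / 2 + if p.2 then d else -d) ≤ Real.exp (256 * d ^ 2) := by
      intro p
      have h := second_moment_le (hcl p).1 (hcl p).2.1 (hcl p).2.2
      have e : (if p.2 then d else -d) ^ 2 = d ^ 2 := by split_ifs <;> ring
      rwa [e] at h
    calc _ ≤ ∏ _p : Fin (ℓ + s) × Bool, Real.exp (256 * d ^ 2) := by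
          refine prod_le_prod (fun p _ => ?_) (fun p _ => hle p)
          have h1 := (hcl p).1
          have h2 : 0 < 1 - (1 - f) ^ (1 / 2 + if p.2 then d else -d) := by
            linarith [(hcl p).2.1]
          positivity
      _ = Real.exp (((ℓ + s) * 2 : ℕ) * (256 * d ^ 2)) := by
          rw [prod_const, card_univ, Fintype.card_prod, Fintype.card_fin, Fintype.card_bool,
            ← Real.exp_nat_mul]
      _ ≤ Real.exp 1024 := by
          refine Real.exp_le_exp.mpr ?_
          have hsℓ : (s : ℝ) ≤ ℓ := by exact_mod_cast (by omega : s ≤ ℓ)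
          push_cast
          nlinarith [sq_nonneg d]
  have hS : 0 ≤ ∑ ω ∈ attackPatterns (ℓ + s) s ℓ,
      patternWeight (fun p => (1 - f) ^ (1 / 2 + if p.2 then d else -d)) ω :=
    sum_nonneg fun ω _ => (patternWeight_pos (fun p => (hcl p).1) (fun p => (hcl p).2.1) ω).le
  -- Squaring the bound `1 / 4` of the symmetric case produces the denominator `16`.
  have h1 := pow_le_pow_left₀ (by norm_num) hquarter 2
  have h2 := (h1.trans hCS).trans (mul_le_mul_of_nonneg_left hprod hS)
  rw [Real.exp_neg, inv_eq_one_div, div_div, div_le_iff₀ (by positivity)]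
  linarith

end Minotaur

namespace Minotaur

open MeasureTheory ProbabilityTheory

/-! ### The law of the lottery -/

section Lottery

variable {P : Type}

instance : IsProbabilityMeasure (coinLaw P) := by
  unfold coinLaw; infer_instance

/-- Some party in `D` is elected in slot `r`, with thresholds `τ`. -/
def Hit (τ : P → ℝ) (D : Finset P) (x : Coins P) (r : ℕ) : Prop :=
  ∃ i ∈ D, (x (r, i, false) : ℝ) < τ i

open Classical in
/-- The pattern of hits in the `N` slots after slot `t`. -/
noncomputable def hitPattern (τ : P → ℝ) (D : Bool → Finset P) (t N : ℕ) (x : Coins P) :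
    Fin N × Bool → Bool :=
  fun p => decide (Hit τ (D p.2) x (t + p.1 + 1))

lemma volume_threshold {τ : ℝ} (h0 : 0 ≤ τ) (h1 : τ ≤ 1) :
    (volume : Measure unitInterval) {u | τ ≤ (u : ℝ)} = ENNReal.ofReal (1 - τ) :=
  unitInterval.volume_Ici ⟨τ, h0, h1⟩

lemma measurableSet_not_hit (τ : P → ℝ) (D : Finset P) (r : ℕ) :
    MeasurableSet {x : Coins P | ¬ Hit τ D x r} := by
  have : {x : Coins P | ¬ Hit τ D x r} =
      ⋂ i ∈ D, {x : Coins P | τ i ≤ (x (r, i, false) : ℝ)} := by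
    ext x; simp [Hit]
  rw [this]
  refine Finset.measurableSet_biInter _ fun i _ => measurableSet_le measurable_const ?_
  exact measurable_subtype_coe.comp (measurable_pi_apply _)

/-- The event is a box in coin space. Distinct slots, and distinct sides because they are disjoint,
use disjoint sets of coordinates, so its measure is a product. -/
lemma coinLaw_biInter_not_hit {τ : P → ℝ} (h0 : ∀ i, 0 ≤ τ i) (h1 : ∀ i, τ i ≤ 1)
    {D : Bool → Finset P} (hD : Disjoint (D true) (D false)) (t : ℕ) {N : ℕ}
    (s : Finset (Fin N × Bool)) :
    coinLaw P (⋂ p ∈ s, {x | ¬ Hit τ (D p.2) x (t + p.1 + 1)}) =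
      ∏ p ∈ s, ∏ i ∈ D p.2, ENNReal.ofReal (1 - τ i) := by
  classical
  let I : Fin N × Bool → Finset (ℕ × P × Bool) :=
    fun p => (D p.2).image fun i => (t + p.1 + 1, i, false)
  have hI : ((s : Set (Fin N × Bool))).PairwiseDisjoint I := by
    rintro ⟨n, b⟩ _ ⟨n', b'⟩ _ hne
    refine Finset.disjoint_left.mpr fun z hz hz' => hne ?_
    simp only [I, Finset.mem_image] at hz hz'
    obtain ⟨i, hi, rfl⟩ := hz
    obtain ⟨j, hj, h⟩ := hz'
    simp only [Prod.mk.injEq, and_true] at h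
    obtain ⟨hn, rfl⟩ := h
    have hn' : n = n' := Fin.ext (by omega)
    have hb : b = b' := by
      cases b <;> cases b' <;> first | rfl | skip
      · exact absurd hi (Finset.disjoint_left.mp hD hj)
      · exact absurd hj (Finset.disjoint_left.mp hD hi)
    rw [hn', hb]
  have hset : (⋂ p ∈ s, {x : Coins P | ¬ Hit τ (D p.2) x (t + p.1 + 1)}) =
      ((s.biUnion I : Finset (ℕ × P × Bool)) : Set (ℕ × P × Bool)).pi
        (fun z => {u : unitInterval | τ z.2.1 ≤ (u : ℝ)}) := by
    ext x
    simp only [Hit, Set.mem_iInter, Set.mem_ofPred_eq, not_exists, not_and, not_lt, Set.mem_pi,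
      Finset.coe_biUnion, Set.mem_iUnion, I, Finset.coe_image, Set.mem_image, Finset.mem_coe]
    constructor
    · rintro h z ⟨p, hp, i, hi, rfl⟩
      exact h p hp i hi
    · intro h p hp i hi
      exact h _ ⟨p, hp, i, hi, rfl⟩
  rw [hset, coinLaw, Measure.infinitePi_pi _ fun z _ =>
    measurableSet_le measurable_const measurable_subtype_coe, Finset.prod_biUnion hI]
  refine Finset.prod_congr rfl fun p _ => ?_
  rw [Finset.prod_image fun i _ j _ h => by simpa using h]
  exact Finset.prod_congr rfl fun i _ => volume_threshold (h0 i) (h1 i)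

/-- The events without a hit are independent, hence so are the σ-algebras that they generate; this
allows complements at the coordinates with a hit. -/
lemma coinLaw_hitPattern_eq {τ : P → ℝ} (h0 : ∀ i, 0 ≤ τ i) (h1 : ∀ i, τ i ≤ 1)
    {D : Bool → Finset P} (hD : Disjoint (D true) (D false)) (t : ℕ) {N : ℕ}
    (ω : Fin N × Bool → Bool) :
    coinLaw P {x | hitPattern τ D t N x = ω} =
      ENNReal.ofReal (patternWeight (fun p => ∏ i ∈ D p.2, (1 - τ i)) ω) := by
  let F : Fin N × Bool → Set (Coins P) := fun p => {x | ¬ Hit τ (D p.2) x (t + p.1 + 1)}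
  have hF : ∀ p, MeasurableSet (F p) := fun p => measurableSet_not_hit _ _ _
  have hn : ∀ i, 0 ≤ 1 - τ i := fun i => by linarith [h1 i]
  have hFp : ∀ p, coinLaw P (F p) = ENNReal.ofReal (∏ i ∈ D p.2, (1 - τ i)) := by
    intro p
    have := coinLaw_biInter_not_hit h0 h1 hD t {p}
    simp only [Finset.mem_singleton, Set.iInter_iInter_eq_left, Finset.prod_singleton] at this
    rw [ENNReal.ofReal_prod_of_nonneg fun i _ => hn i]
    exact this
  have hind : iIndepSet F (coinLaw P) := by
    rw [iIndepSet_iff_meas_biInter hF]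
    intro s
    rw [coinLaw_biInter_not_hit h0 h1 hD t s]
    refine Finset.prod_congr rfl fun p _ => ?_
    rw [hFp p, ENNReal.ofReal_prod_of_nonneg fun i _ => hn i]
  have hind' : iIndep (fun p => MeasurableSpace.generateFrom {F p}) (coinLaw P) := hind
  have hset : {x | hitPattern τ D t N x = ω} = ⋂ p, if ω p = true then (F p)ᶜ else F p := by
    ext x
    simp only [Set.mem_ofPred_eq, Set.mem_iInter, funext_iff, hitPattern]
    refine forall_congr' fun p => ?_
    cases h : ω p <;> simp [F]
  rw [hset, hind'.meas_iInter fun p => ?_]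
  · rw [patternWeight, ENNReal.ofReal_prod_of_nonneg]
    · refine Finset.prod_congr rfl fun p _ => ?_
      cases h : ω p
      · simp [boolWeight, hFp]
      · have hnn : 0 ≤ ∏ i ∈ D p.2, (1 - τ i) := Finset.prod_nonneg fun i _ => hn i
        simp [boolWeight, prob_compl_eq_one_sub (hF p), hFp, ENNReal.ofReal_sub 1 hnn]
    · intro p _
      have h2 : 0 ≤ ∏ i ∈ D p.2, (1 - τ i) := Finset.prod_nonneg fun i _ => hn i
      have h3 : ∏ i ∈ D p.2, (1 - τ i) ≤ 1 :=
        Finset.prod_le_one (fun i _ => hn i) fun i _ => by linarith [h0 i]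
      cases ω p <;> simp [boolWeight, h2, h3]
  · have hm : MeasurableSet[MeasurableSpace.generateFrom {F p}] (F p) :=
      MeasurableSpace.measurableSet_generateFrom rfl
    split_ifs
    · exact hm.compl
    · exact hm

lemma ofReal_sum_patternWeight_le {τ : P → ℝ} (h0 : ∀ i, 0 ≤ τ i) (h1 : ∀ i, τ i ≤ 1)
    {D : Bool → Finset P} (hD : Disjoint (D true) (D false)) (t : ℕ) {N : ℕ}
    (E : Finset (Fin N × Bool → Bool)) :
    ENNReal.ofReal (∑ ω ∈ E, patternWeight (fun p => ∏ i ∈ D p.2, (1 - τ i)) ω) ≤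
      coinLaw P {x | hitPattern τ D t N x ∈ E} := by
  have hms : ∀ ω : Fin N × Bool → Bool, MeasurableSet {x : Coins P | hitPattern τ D t N x = ω} := by
    intro ω
    have : {x | hitPattern τ D t N x = ω} =
        ⋂ p : Fin N × Bool, if ω p = true then {x | ¬ Hit τ (D p.2) x (t + p.1 + 1)}ᶜ
          else {x | ¬ Hit τ (D p.2) x (t + p.1 + 1)} := by
      ext x
      simp only [Set.mem_ofPred_eq, Set.mem_iInter, funext_iff, hitPattern]
      refine forall_congr' fun p => ?_
      cases h : ω p <;> simp
    rw [this]
    refine MeasurableSet.iInter fun p => ?_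
    split_ifs
    · exact (measurableSet_not_hit _ _ _).compl
    · exact measurableSet_not_hit _ _ _
  have hset : {x | hitPattern τ D t N x ∈ E} = ⋃ ω ∈ E, {x | hitPattern τ D t N x = ω} := by
    ext x; simp
  rw [hset, measure_biUnion_finset (fun ω _ ω' _ hne => ?_) fun ω _ => hms ω]
  · rw [← Finset.sum_congr rfl fun ω _ => (coinLaw_hitPattern_eq h0 h1 hD t ω).symm]
    rw [ENNReal.ofReal_sum_of_nonneg]
    intro ω _
    refine Finset.prod_nonneg fun p _ => ?_
    have h2 : 0 ≤ ∏ i ∈ D p.2, (1 - τ i) :=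
      Finset.prod_nonneg fun i _ => by linarith [h1 i]
    have h3 : ∏ i ∈ D p.2, (1 - τ i) ≤ 1 :=
      Finset.prod_le_one (fun i _ => by linarith [h1 i]) fun i _ => by linarith [h0 i]
    cases ω p <;> simp [boolWeight, h2, h3]
  · exact Set.disjoint_left.mpr fun x hx hx' => hne (hx.symm.trans hx')

end Lottery

end Minotaur

namespace Minotaur

/-! ### Virtual stake -/

section Stake

variable {P : Type}

/-- New blocks lie after the window, and old blocks refer to table positions that do not change when
the table grows at its end. -/
lemma powsIn_append {W₀ W' : List (PowBlock P)} {C₀ E : Chain P} {t a b : ℕ} (hb : b ≤ t)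
    (hpows : ∀ B ∈ C₀, ∀ j ∈ B.pows, j < W₀.length) (hE : ∀ B ∈ E, t < B.slot) :
    powsIn (W₀ ++ W') (C₀ ++ E) a b = powsIn W₀ C₀ a b := by
  unfold powsIn
  have hnil : E.filter (fun B => decide (a < B.slot ∧ B.slot ≤ b)) = [] := by
    rw [List.filter_eq_nil_iff]
    intro B hB
    have := hE B hB
    simp only [decide_eq_true_eq, not_and]
    omega
  rw [List.filter_append, hnil, List.append_nil]
  refine List.flatMap_congr fun B hB => ?_
  refine List.filterMap_congr fun j hj => ?_
  exact List.getElem?_append_left (hpows B (List.mem_of_mem_filter hB) j hj)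

lemma mem_of_mem_powsIn {W : List (PowBlock P)} {C : Chain P} {a b : ℕ} {w : PowBlock P}
    (hw : w ∈ powsIn W C a b) : w ∈ W := by
  simp only [powsIn, List.mem_flatMap, List.mem_filterMap] at hw
  obtain ⟨B, _, j, _, hj⟩ := hw
  exact List.mem_of_getElem? hj

lemma difficulty_nonneg {L : List (PowBlock P)} (hL : ∀ w ∈ L, 0 < w.target) :
    0 ≤ difficulty L := by
  refine List.sum_nonneg fun y hy => ?_
  obtain ⟨w, hw, rfl⟩ := List.mem_map.mp hy
  exact (one_div_pos.mpr (hL w hw)).le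

/-- Independent aggregation: only the total virtual stake of a set of parties matters for whether it
has a hit. -/
lemma prod_one_sub_phi {f : ℝ} (hf : f < 1) (D : Finset P) (v : P → ℝ) :
    ∏ i ∈ D, (1 - phi f (v i)) = (1 - f) ^ (∑ i ∈ D, v i) := by
  rw [Real.rpow_sum_of_pos (by linarith)]
  simp [phi]

variable [Fintype P]

open Classical in
lemma sum_difficulty_filter_miner (L : List (PowBlock P)) :
    ∑ i, difficulty (L.filter fun w => decide (w.miner = i)) = difficulty L := by
  induction L with
  | nil => simp [difficulty]
  | cons w L ih =>
    have h : ∀ i, difficulty ((w :: L).filter fun w => decide (w.miner = i)) =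
        (if w.miner = i then 1 / w.target else 0) +
          difficulty (L.filter fun w => decide (w.miner = i)) := by
      intro i
      by_cases hi : w.miner = i <;> simp [difficulty, hi]
    rw [Finset.sum_congr rfl fun i _ => h i, Finset.sum_add_distrib, ih]
    simp [difficulty]

lemma stakeShare_nonneg (S : Setup P) (i : P) : 0 ≤ stakeShare S i :=
  div_nonneg (S.stake_nonneg i) S.stake_pos.le

lemma sum_stakeShare (S : Setup P) : ∑ i, stakeShare S i = 1 := by
  simp only [stakeShare, ← Finset.sum_div]
  exact div_self S.stake_pos.ne'

lemma virtualStake_nonneg (Q : Params) (S : Setup P) {W : List (PowBlock P)}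
    (hW : ∀ w ∈ W, 0 < w.target) (C : Chain P) (e : ℕ) (i : P) :
    0 ≤ virtualStake Q S W C e i := by
  unfold virtualStake
  split_ifs
  · exact stakeShare_nonneg S i
  · have h1 := Q.ω_nonneg
    have h2 : 0 ≤ 1 - Q.ω := by linarith [Q.ω_le_one]
    refine add_nonneg (mul_nonneg h2 (stakeShare_nonneg S i)) (mul_nonneg h1 (div_nonneg ?_ ?_))
    · exact difficulty_nonneg fun w hw => hW w (mem_of_mem_powsIn (List.mem_of_mem_filter hw))
    · exact difficulty_nonneg fun w hw => hW w (mem_of_mem_powsIn hw)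

lemma sum_virtualStake (Q : Params) (S : Setup P) (W : List (PowBlock P)) (C : Chain P) (e : ℕ) :
    ∑ i, virtualStake Q S W C e i = 1 := by
  unfold virtualStake
  split_ifs with h
  · exact sum_stakeShare S
  · push Not at h
    have hD : difficulty (powsIn W C ((e - 2 - 1) * Q.R) ((e - 2) * Q.R)) ≠ 0 := h.2
    rw [Finset.sum_add_distrib, ← Finset.mul_sum, ← Finset.mul_sum, sum_stakeShare]
    simp only [workShare, ← Finset.sum_div, sum_difficulty_filter_miner]
    rw [div_self hD]
    ring

/-- Work stake is read off from epoch `e - 2`, so nothing that is appended during epoch `e` can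
alter the thresholds of that epoch. Both branches of the attack therefore play the same lottery. -/
lemma virtualStake_append (Q : Params) (S : Setup P) {W₀ W' : List (PowBlock P)} {C₀ E : Chain P}
    {e : ℕ} (hpows : ∀ B ∈ C₀, ∀ j ∈ B.pows, j < W₀.length)
    (hE : ∀ B ∈ E, (e - 1) * Q.R < B.slot) (i : P) :
    virtualStake Q S (W₀ ++ W') (C₀ ++ E) e i = virtualStake Q S W₀ C₀ e i := by
  have hb : (e - 2) * Q.R ≤ (e - 1) * Q.R := Nat.mul_le_mul_right _ (by omega)
  unfold virtualStake workShare
  rw [powsIn_append hb hpows hE, powsIn_append hb hpows hE]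

lemma phi_nonneg {f v : ℝ} (h0 : 0 < f) (h1 : f < 1) (hv : 0 ≤ v) : 0 ≤ phi f v := by
  have := Real.rpow_le_one (by linarith : 0 ≤ 1 - f) (by linarith) hv
  unfold phi; linarith

lemma phi_le_one {f v : ℝ} (h1 : f < 1) : phi f v ≤ 1 := by
  have := Real.rpow_nonneg (by linarith : 0 ≤ 1 - f) v
  unfold phi; linarith

end Stake

/-! ### Slots with hits -/

section HitSlots

variable {P : Type}

open Classical in
/-- The slots with a hit among the `n` slots after slot `t`. -/
noncomputable def hitSlots (τ : P → ℝ) (D : Finset P) (x : Coins P) (t : ℕ) : ℕ → List ℕ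
  | 0 => []
  | n + 1 => hitSlots τ D x t n ++ if Hit τ D x (t + n + 1) then [t + n + 1] else []

variable {τ : P → ℝ} {D : Finset P} {x : Coins P} {t : ℕ}

lemma hitSlots_succ_of_hit {n : ℕ} (h : Hit τ D x (t + n + 1)) :
    hitSlots τ D x t (n + 1) = hitSlots τ D x t n ++ [t + n + 1] := by
  simp [hitSlots, h]

lemma hitSlots_succ_of_not_hit {n : ℕ} (h : ¬ Hit τ D x (t + n + 1)) :
    hitSlots τ D x t (n + 1) = hitSlots τ D x t n := by
  simp [hitSlots, h]

lemma hitSlots_prefix_succ (n : ℕ) : hitSlots τ D x t n <+: hitSlots τ D x t (n + 1) :=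
  List.prefix_append _ _

lemma hitSlots_prefix {n N : ℕ} (h : n ≤ N) : hitSlots τ D x t n <+: hitSlots τ D x t N := by
  induction N, h using Nat.le_induction with
  | base => exact List.prefix_rfl
  | succ N _ ih => exact ih.trans (hitSlots_prefix_succ N)

lemma lt_of_mem_hitSlots {n r : ℕ} (h : r ∈ hitSlots τ D x t n) : t < r := by
  induction n with
  | zero => simp [hitSlots] at h
  | succ n ih =>
    by_cases hh : Hit τ D x (t + n + 1)
    · rw [hitSlots_succ_of_hit hh, List.mem_append, List.mem_singleton] at h
      rcases h with h | h
      · exact ih h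
      · omega
    · exact ih (hitSlots_succ_of_not_hit hh ▸ h)

lemma le_of_mem_hitSlots {n r : ℕ} (h : r ∈ hitSlots τ D x t n) : r ≤ t + n := by
  induction n with
  | zero => simp [hitSlots] at h
  | succ n ih =>
    by_cases hh : Hit τ D x (t + n + 1)
    · rw [hitSlots_succ_of_hit hh, List.mem_append, List.mem_singleton] at h
      rcases h with h | h
      · have := ih h; omega
      · omega
    · have := ih (hitSlots_succ_of_not_hit hh ▸ h); omega

lemma exists_hitSlots_eq_cons {n N : ℕ} (hn : n < N) (h : Hit τ D x (t + n + 1)) :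
    ∃ r l, hitSlots τ D x t N = r :: l ∧ r ≤ t + n + 1 := by
  obtain ⟨l', hl'⟩ := hitSlots_prefix (τ := τ) (D := D) (x := x) (t := t) (Nat.succ_le_of_lt hn)
  have hmem : t + n + 1 ∈ hitSlots τ D x t (n + 1) := by simp [hitSlots_succ_of_hit h]
  cases hl : hitSlots τ D x t (n + 1) with
  | nil => simp [hl] at hmem
  | cons r l =>
    refine ⟨r, l ++ l', by rw [← hl', Nat.succ_eq_add_one, hl, List.cons_append], ?_⟩
    have : r ∈ hitSlots τ D x t (n + 1) := by simp [hl]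
    have := le_of_mem_hitSlots this
    omega

lemma length_hitSlots (τ : P → ℝ) (D : Bool → Finset P) (x : Coins P) (t N : ℕ) (b : Bool) :
    (hitSlots τ (D b) x t N).length = hits (hitPattern τ D t N x) b := by
  classical
  have hcard : hits (hitPattern τ D t N x) b =
      ∑ n ∈ Finset.range N, if Hit τ (D b) x (t + n + 1) then 1 else 0 := by
    rw [hits, Finset.card_filter,
      ← Fin.sum_univ_eq_sum_range fun n => if Hit τ (D b) x (t + n + 1) then 1 else 0]
    simp [hitPattern]
  rw [hcard]
  induction N with
  | zero => simp [hitSlots]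
  | succ N ih =>
    rw [Finset.sum_range_succ, hitSlots, List.length_append, ih (by
      rw [hits, Finset.card_filter,
        ← Fin.sum_univ_eq_sum_range fun n => if Hit τ (D b) x (t + n + 1) then 1 else 0]
      simp [hitPattern])]
    split_ifs <;> simp

end HitSlots

/-! ### The private chain attack -/

section Attack

variable {P : Type}

lemma headSlot_lt {C : Chain P} {r : ℕ} (hr : 0 < r) (h : ∀ B ∈ C, B.slot < r) :
    headSlot C < r := by
  unfold headSlot
  cases hl : C.getLast? with
  | none => simpa using hr
  | some B => simpa using h B (List.mem_of_getLast? hl)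

/-- A longest chain in the view is held, if it extends `C₀`. -/
lemma mem_held_of_longest {Q : Params} {C₀ : Chain P} {st : State P} {a : Action P} {i : P} {C : Chain P} {m : ℕ}
    (hC : C ∈ view st a i) (hpre : C₀ <+: C) (hcur : C₀ <+: st.cur i)
    (hcur_le : (st.cur i).length ≤ C₀.length + m) (hm : m ≤ Q.k) (hlen : C.length = C₀.length + m)
    (hmax : ∀ C' ∈ view st a i, C'.length ≤ C₀.length + m) : C ∈ held Q st a i :=
  ⟨hC, ⟨C₀, hcur, hpre, by omega⟩, fun C' hC' _ => hlen ▸ hmax C' hC'⟩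

lemma adopt_mem_held {Q : Params} {st : State P} {a : Action P} {i : P} (h : (held Q st a i).Nonempty) :
    adopt Q st a i ∈ held Q st a i := by
  unfold adopt
  split_ifs with h'
  · exact h'
  · exact h.some_mem

variable [Fintype P]

/-- `C` extends `C₀` by blocks of corrupted parties with timestamps after slot `t`. -/
def IsPrivate (S : Setup P) (t : ℕ) (C₀ C : Chain P) : Prop :=
  ∃ E : Chain P, C = C₀ ++ E ∧ ∀ B ∈ E, B.issuer ∈ S.corrupt ∧ t < B.slot

/-- The adversary builds a private chain on top of `C₀` and delivers it in slot `t + N + 1`, cut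
to the length of the public chain. -/
def privateAttack (S : Setup P) (t N : ℕ) (C₀ : Chain P) : Adversary P := fun r st =>
  { deliver := fun _ =>
      -- A strictly longer private chain would displace the public one; the cap on the length
      -- creates a tie, so that both are held in the same slot.
      {C | r = t + N + 1 ∧ IsPrivate S t C₀ C ∧ ∃ C' ∈ st.pub, C.length ≤ C'.length}
    release := ∅
    propose := {p | IsPrivate S t C₀ p.1 ∧ p.2.2 = []}
    query := fun _ => (0, []) }

open Classical in
/-- The honest (`true`) and the corrupted (`false`) parties. -/
noncomputable def Setup.side (S : Setup P) (b : Bool) : Finset P :=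
  if b then S.corruptᶜ else S.corrupt

lemma Setup.mem_side_true {S : Setup P} {i : P} : i ∈ S.side true ↔ i ∉ S.corrupt := by
  simp [Setup.side]

lemma Setup.mem_side_false {S : Setup P} {i : P} : i ∈ S.side false ↔ i ∈ S.corrupt := by
  simp [Setup.side]

lemma Setup.disjoint_side (S : Setup P) : Disjoint (S.side true) (S.side false) :=
  Finset.disjoint_left.mpr fun _ h h' => mem_side_true.mp h (mem_side_false.mp h')

lemma epoch_eq {R e n : ℕ} (he : 1 ≤ e) (hn : n < R) : epoch R ((e - 1) * R + n + 1) = e := by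
  unfold epoch
  rw [Nat.add_sub_cancel, Nat.mul_comm, Nat.mul_add_div (by omega), Nat.div_eq_of_lt hn]
  omega

/-- What holds after `n` slots of the private chain attack on top of `C₀`, if `H` are the slots
with an election of an honest party and `a` is the number of slots with an election of a corrupted
party. -/
structure AttackInvariant (S : Setup P) (t n : ℕ) (st₀ : State P) (C₀ : Chain P) (H : List ℕ)
    (a : ℕ) (st : State P) : Prop where
  pub_le : ∀ C ∈ st.pub, C.length ≤ C₀.length + H.length
  -- This covers every longest public chain, since it is left open which one a party adopts. Several
  -- honest leaders in one slot create chains of equal length with the same list of slots.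
  pub_longest : ∀ C ∈ st.pub, C.length = C₀.length + H.length →
    ∃ E, C = C₀ ++ E ∧ (∀ B ∈ E, B.issuer ∉ S.corrupt) ∧ E.map Block.slot = H
  exists_longest : ∃ C ∈ st.pub, C.length = C₀.length + H.length
  cur_prefix : ∀ i, i ∉ S.corrupt → C₀ <+: st.cur i
  cur_le : ∀ i, i ∉ S.corrupt → (st.cur i).length ≤ C₀.length + H.length
  pows_prefix : st₀.pows <+: st.pows
  -- All lengths up to `a` are needed, because the delivered chain has to match the public length
  -- exactly.
  exists_private : ∀ l ≤ a, ∃ E : Chain P, C₀ ++ E ∈ st.chains ∧ E.length = l ∧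
    ∀ B ∈ E, B.issuer ∈ S.corrupt ∧ t < B.slot ∧ B.slot ≤ t + n

/-! ### Preservation of the attack invariant, and success of the attack -/

variable {Q : Params} {S : Setup P} {st₀ : State P} {C₀ : Chain P}

lemma attackInvariant_zero {t : ℕ} (h : Agreement S t st₀ C₀) :
    AttackInvariant S t 0 st₀ C₀ [] 0 st₀ where
  pub_le C hC := by
    by_cases hne : C = C₀
    · simp [hne]
    · exact (h.pub_shorter C hC hne).le
  pub_longest C hC hl := by
    by_cases hne : C = C₀
    · exact ⟨[], by simp [hne]⟩
    · have := h.pub_shorter C hC hne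
      simp only [List.length_nil, add_zero] at hl
      omega
  exists_longest := ⟨C₀, h.mem_pub, rfl⟩
  cur_prefix i hi := by rw [h.cur_eq i hi]
  cur_le i hi := by rw [h.cur_eq i hi]; simp
  pows_prefix := List.prefix_rfl
  exists_private l hl := ⟨[], by simpa using h.mem_chains, by simp at hl ⊢; omega, by simp⟩

/-- With nothing delivered by the adversary, honest parties adopt a longest public chain. -/
lemma AttackInvariant.adopt_spec {t n a : ℕ} {H : List ℕ} {st : State P} {act : Action P}
    (h : AttackInvariant S t n st₀ C₀ H a st) (hH : H.length ≤ Q.k)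
    (hdel : ∀ i, act.deliver i = ∅) {i : P} (hi : i ∉ S.corrupt) :
    adopt Q st act i ∈ st.pub ∧ (adopt Q st act i).length = C₀.length + H.length := by
  have hview : view st act i = st.pub := by simp [view, hdel]
  obtain ⟨C, hC, hlen⟩ := h.exists_longest
  obtain ⟨E, rfl, _⟩ := h.pub_longest C hC hlen
  have hheld : C₀ ++ E ∈ held Q st act i :=
    mem_held_of_longest (hview ▸ hC) (List.prefix_append _ _) (h.cur_prefix i hi) (h.cur_le i hi)
      hH hlen (hview ▸ h.pub_le)
  have had := adopt_mem_held ⟨_, hheld⟩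
  have hmem : adopt Q st act i ∈ st.pub := hview ▸ had.1
  refine ⟨hmem, le_antisymm (h.pub_le _ hmem) ?_⟩
  rw [← hlen]
  exact had.2.2 _ hheld.1 hheld.2.1

variable {e : ℕ}

/-- Election thresholds in epoch `e` according to `C₀`. -/
noncomputable def thresholds (Q : Params) (S : Setup P) (st₀ : State P) (C₀ : Chain P) (e : ℕ)
    (i : P) : ℝ :=
  phi Q.f (virtualStake Q S st₀.pows C₀ e i)

/-- Election on top of any extension of `C₀` by blocks of the current epoch is decided by thresholds
that are known at its start. -/
lemma elected_iff {t n : ℕ} (he : 1 ≤ e) (ht : t = (e - 1) * Q.R) (hn : n < Q.R)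
    (hA : Agreement S t st₀ C₀) {W : List (PowBlock P)} (hW : st₀.pows <+: W) {E : Chain P}
    (hE : ∀ B ∈ E, t < B.slot) (x : Coins P) (i : P) :
    Elected Q S x W (C₀ ++ E) (t + n + 1) i ↔
      (x (t + n + 1, i, false) : ℝ) < thresholds Q S st₀ C₀ e i := by
  obtain ⟨W', rfl⟩ := hW
  subst ht
  rw [Elected, epoch_eq he hn,
    virtualStake_append Q S (hA.pows_lt C₀ hA.mem_chains) hE, thresholds]

lemma attackInvariant_step {t n N a : ℕ} {H H' : List ℕ} {a' : ℕ} {st : State P} {x : Coins P}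
    (he : 1 ≤ e) (ht : t = (e - 1) * Q.R) (hnN : n < N) (hn : n < Q.R)
    (hA : Agreement S t st₀ C₀) (h : AttackInvariant S t n st₀ C₀ H a st) (hk : H.length ≤ Q.k)
    (hslot : ∀ r ∈ H, t < r)
    (hH' : Hit (thresholds Q S st₀ C₀ e) (S.side true) x (t + n + 1) → H' = H ++ [t + n + 1])
    (hH : ¬ Hit (thresholds Q S st₀ C₀ e) (S.side true) x (t + n + 1) → H' = H)
    (ha' : Hit (thresholds Q S st₀ C₀ e) (S.side false) x (t + n + 1) → a' = a + 1)
    (ha : ¬ Hit (thresholds Q S st₀ C₀ e) (S.side false) x (t + n + 1) → a' = a) :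
    AttackInvariant S t (n + 1) st₀ C₀ H' a'
      (step Q S x st (t + n + 1) (privateAttack S t N C₀ (t + n + 1) st)) := by
  obtain ⟨act, hact⟩ : ∃ act, act = privateAttack S t N C₀ (t + n + 1) st := ⟨_, rfl⟩
  rw [← hact]
  -- Delivery is reserved for slot `t + N + 1`, which is not reached as `n < N`.
  have hdel : ∀ i, act.deliver i = ∅ := by
    intro i
    ext C
    simp only [hact, privateAttack, Set.mem_ofPred_eq, Set.mem_empty_iff_false, iff_false]
    omega
  have hview : ∀ i, view st act i = st.pub := fun i => by simp [view, hdel]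
  have hadopt : ∀ i, i ∉ S.corrupt → adopt Q st act i ∈ st.pub ∧
      (adopt Q st act i).length = C₀.length + H.length ∧ ∃ E, adopt Q st act i = C₀ ++ E ∧
      (∀ B ∈ E, B.issuer ∉ S.corrupt) ∧ E.map Block.slot = H := by
    intro i hi
    obtain ⟨h1, h2⟩ := h.adopt_spec hk hdel hi
    exact ⟨h1, h2, h.pub_longest _ h1 h2⟩
  have hchain : ∀ i, i ∉ S.corrupt →
      ((x (t + n + 1, i, false) : ℝ) < thresholds Q S st₀ C₀ e i ∧
        honestChain Q S x st (t + n + 1) act i = adopt Q st act i ++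
          [honestBlock Q S st (t + n + 1) (adopt Q st act i) i]) ∨
      (¬ (x (t + n + 1, i, false) : ℝ) < thresholds Q S st₀ C₀ e i ∧
        honestChain Q S x st (t + n + 1) act i = adopt Q st act i) := by
    intro i hi
    obtain ⟨_, _, E, hE, _, hmap⟩ := hadopt i hi
    have hel := elected_iff he ht hn hA h.pows_prefix (E := E) (fun B hB => hslot _ (by
      rw [← hmap]; exact List.mem_map_of_mem hB)) x i
    rw [← hE] at hel
    unfold honestChain
    by_cases hx : (x (t + n + 1, i, false) : ℝ) < thresholds Q S st₀ C₀ e i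
    · exact .inl ⟨hx, by simp [hel.mpr hx]⟩
    · exact .inr ⟨hx, by simp [mt hel.mp hx]⟩
  have hHlen : H.length ≤ H'.length := by
    by_cases hh : Hit (thresholds Q S st₀ C₀ e) (S.side true) x (t + n + 1)
    · rw [hH' hh]; simp
    · rw [hH hh]
  have hchain_le : ∀ i, i ∉ S.corrupt →
      (honestChain Q S x st (t + n + 1) act i).length ≤ C₀.length + H'.length := by
    intro i hi
    obtain ⟨_, h2, _⟩ := hadopt i hi
    rcases hchain i hi with ⟨hx, hc⟩ | ⟨_, hc⟩
    · rw [hc, hH' ⟨i, Setup.mem_side_true.mpr hi, hx⟩]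
      simp only [List.length_append, List.length_singleton]
      omega
    · rw [hc]; omega
  have hpub : (step Q S x st (t + n + 1) act).pub ⊆
      st.pub ∪ {C | ∃ i, i ∉ S.corrupt ∧ C = honestChain Q S x st (t + n + 1) act i} := by
    intro C hC
    simp only [step, Set.mem_union, Set.mem_ofPred_eq] at hC ⊢
    rcases hC with hC | ⟨i, _, hC⟩
    · exact hC
    · exact .inl (hview i ▸ hC)
  refine ⟨?_, ?_, ?_, ?_, hchain_le, ?_, ?_⟩
  · intro C hC
    rcases hpub hC with hC | ⟨i, hi, rfl⟩
    · have := h.pub_le C hC; omega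
    · exact hchain_le i hi
  · intro C hC hlen
    by_cases hh : Hit (thresholds Q S st₀ C₀ e) (S.side true) x (t + n + 1)
    · rw [hH' hh] at hlen ⊢
      simp only [List.length_append, List.length_singleton] at hlen
      -- After an honest hit, older public chains are too short to be longest, so the chain ends in
      -- an honest block of this very slot.
      rcases hpub hC with hC | ⟨i, hi, rfl⟩
      · have := h.pub_le C hC; omega
      · obtain ⟨_, h2, E, hE, hhon, hmap⟩ := hadopt i hi
        rcases hchain i hi with ⟨_, hc⟩ | ⟨_, hc⟩
        · refine ⟨E ++ [honestBlock Q S st (t + n + 1) (adopt Q st act i) i], ?_, ?_, ?_⟩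
          · rw [hc, ← List.append_assoc, ← hE]
          · intro B hB
            rcases List.mem_append.mp hB with hB | hB
            · exact hhon B hB
            · rw [List.mem_singleton.mp hB]; exact hi
          · rw [List.map_append, hmap]; rfl
        · rw [hc] at hlen; omega
    · rw [hH hh] at hlen ⊢
      rcases hpub hC with hC | ⟨i, hi, rfl⟩
      · exact h.pub_longest C hC hlen
      · rcases hchain i hi with ⟨hx, _⟩ | ⟨_, hc⟩
        · exact absurd ⟨i, Setup.mem_side_true.mpr hi, hx⟩ hh
        · rw [hc]; exact (hadopt i hi).2.2
  · by_cases hh : Hit (thresholds Q S st₀ C₀ e) (S.side true) x (t + n + 1)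
    · rw [hH' hh]
      obtain ⟨i, hi, hx⟩ := hh
      have hi := Setup.mem_side_true.mp hi
      refine ⟨honestChain Q S x st (t + n + 1) act i, .inl (.inr ⟨i, hi, rfl⟩), ?_⟩
      rcases hchain i hi with ⟨_, hc⟩ | ⟨hx', _⟩
      · rw [hc]
        simp only [List.length_append, List.length_singleton, (hadopt i hi).2.1]
        omega
      · exact absurd hx hx'
    · rw [hH hh]
      obtain ⟨C, hC, hl⟩ := h.exists_longest
      exact ⟨C, .inl (.inl hC), hl⟩
  · intro i hi
    obtain ⟨_, _, E, hE, _⟩ := hadopt i hi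
    change C₀ <+: honestChain Q S x st (t + n + 1) act i
    rcases hchain i hi with ⟨_, hc⟩ | ⟨_, hc⟩
    · rw [hc, hE, List.append_assoc]; exact List.prefix_append _ _
    · rw [hc, hE]; exact List.prefix_append _ _
  · exact h.pows_prefix.trans (List.prefix_append _ _)
  · intro l hl
    have hold : l ≤ a → ∃ E : Chain P, C₀ ++ E ∈ (step Q S x st (t + n + 1) act).chains ∧
        E.length = l ∧ ∀ B ∈ E, B.issuer ∈ S.corrupt ∧ t < B.slot ∧ B.slot ≤ t + (n + 1) := by
      intro hl
      obtain ⟨E, hE, hlen, hB⟩ := h.exists_private l hl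
      exact ⟨E, .inl (.inl hE), hlen, fun B hb => ⟨(hB B hb).1, (hB B hb).2.1, by
        have := (hB B hb).2.2; omega⟩⟩
    by_cases hla : l ≤ a
    · exact hold hla
    by_cases hh : Hit (thresholds Q S st₀ C₀ e) (S.side false) x (t + n + 1)
    · rw [ha' hh] at hl
      obtain ⟨i, hi, hx⟩ := hh
      have hi := Setup.mem_side_false.mp hi
      obtain ⟨E, hE, hlen, hB⟩ := h.exists_private a le_rfl
      refine ⟨E ++ [⟨t + n + 1, i, []⟩], .inr ?_, ?_, ?_⟩
      · refine ⟨C₀ ++ E, i, [], ?_, hE, hi, ?_, ?_, List.nodup_nil, by simp, by simp⟩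
        · rw [hact]
          exact ⟨⟨E, rfl, fun B hb => ⟨(hB B hb).1, (hB B hb).2.1⟩⟩, rfl⟩
        · refine headSlot_lt (by omega) fun B hb => ?_
          rcases List.mem_append.mp hb with hb | hb
          · have := hA.slots_le C₀ hA.mem_chains B hb; omega
          · have := (hB B hb).2.2; omega
        · exact (elected_iff he ht hn hA h.pows_prefix (fun B hb => (hB B hb).2.1) x i).mpr hx
      · simp only [List.length_append, List.length_singleton]; omega
      · intro B hb
        rcases List.mem_append.mp hb with hb | hb
        · exact ⟨(hB B hb).1, (hB B hb).2.1, by have := (hB B hb).2.2; omega⟩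
        · rw [List.mem_singleton.mp hb]
          exact ⟨hi, by simp only; omega, by simp only; omega⟩
    · rw [ha hh] at hl
      exact absurd hl hla

lemma attackInvariant_run {t N n : ℕ} {x : Coins P} (he : 1 ≤ e) (ht : t = (e - 1) * Q.R)
    (hN : N < Q.R) (hA : Agreement S t st₀ C₀)
    (hk : (hitSlots (thresholds Q S st₀ C₀ e) (S.side true) x t N).length ≤ Q.k) (hn : n ≤ N) :
    AttackInvariant S t n st₀ C₀ (hitSlots (thresholds Q S st₀ C₀ e) (S.side true) x t n)
      (hitSlots (thresholds Q S st₀ C₀ e) (S.side false) x t n).length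
      (run Q S (privateAttack S t N C₀) t st₀ x n) := by
  induction n with
  | zero => exact attackInvariant_zero hA
  | succ n ih =>
    refine attackInvariant_step he ht (by omega) (by omega) hA (ih (by omega))
      ((hitSlots_prefix (by omega)).length_le.trans hk) (fun r hr => lt_of_mem_hitSlots hr)
      hitSlots_succ_of_hit hitSlots_succ_of_not_hit (fun h => ?_) (fun h => ?_)
    · rw [hitSlots_succ_of_hit h]; simp
    · rw [hitSlots_succ_of_not_hit h]

/-- The attack succeeds for the right patterns of elections. -/
lemma not_commonPrefix_of_attackPattern {t ℓ s : ℕ} {x : Coins P} (he : 1 ≤ e)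
    (ht : t = (e - 1) * Q.R) (hN : ℓ + s < Q.R) (hℓk : ℓ ≤ Q.k)
    (hA : Agreement S t st₀ C₀)
    (hx : hitPattern (thresholds Q S st₀ C₀ e) S.side t (ℓ + s) x ∈ attackPatterns (ℓ + s) s ℓ) :
    ¬ CommonPrefix Q S (privateAttack S t (ℓ + s) C₀) t st₀ x ℓ Q.R := by
  simp only [attackPatterns, Finset.mem_filter, Finset.mem_univ, true_and, ← length_hitSlots]
    at hx
  obtain ⟨hle, ⟨m, hms, hm⟩, hHℓ⟩ := hx
  have hhit : Hit (thresholds Q S st₀ C₀ e) (S.side true) x (t + m + 1) := by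
    simpa [hitPattern] using hm
  obtain ⟨r, l, hcons, hr⟩ := exists_hitSlots_eq_cons m.2 hhit
  obtain ⟨i, hi, _⟩ := hhit
  have hi := Setup.mem_side_true.mp hi
  have inv := attackInvariant_run (n := ℓ + s) he ht hN hA (hHℓ.trans hℓk) le_rfl
  obtain ⟨H, hH⟩ : ∃ H, H = hitSlots (thresholds Q S st₀ C₀ e) (S.side true) x t (ℓ + s) :=
    ⟨_, rfl⟩
  rw [← hH] at inv hle hHℓ hcons
  obtain ⟨C₁, hC₁, hlen₁⟩ := inv.exists_longest
  obtain ⟨E₁, rfl, hhon, hmap⟩ := inv.pub_longest C₁ hC₁ hlen₁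
  obtain ⟨E₂, hC₂, hlen₂, hcor⟩ := inv.exists_private H.length hle
  intro hCP
  obtain ⟨st, hst⟩ : ∃ st, st = run Q S (privateAttack S t (ℓ + s) C₀) t st₀ x (ℓ + s) :=
    ⟨_, rfl⟩
  rw [← hst] at inv hC₁ hC₂
  have hmax : ∀ C ∈ view st (privateAttack S t (ℓ + s) C₀ (t + (ℓ + s) + 1) st) i,
      C.length ≤ C₀.length + H.length := by
    rintro C (hC | ⟨⟨_, _, C', hC', hle'⟩, _⟩)
    · exact inv.pub_le C hC
    · exact hle'.trans (inv.pub_le C' hC')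
  have hk : H.length ≤ Q.k := hHℓ.trans hℓk
  have held₁ : HeldAt Q S (privateAttack S t (ℓ + s) C₀) t st₀ x (ℓ + s) i (C₀ ++ E₁) := by
    refine ⟨hi, ?_⟩
    rw [← hst]
    exact mem_held_of_longest (.inl hC₁) (List.prefix_append _ _) (inv.cur_prefix i hi)
      (inv.cur_le i hi) hk hlen₁ hmax
  have hlen₂' : (C₀ ++ E₂).length = C₀.length + H.length := by
    rw [List.length_append, hlen₂]
  have held₂ : HeldAt Q S (privateAttack S t (ℓ + s) C₀) t st₀ x (ℓ + s) i (C₀ ++ E₂) := by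
    refine ⟨hi, ?_⟩
    rw [← hst]
    refine mem_held_of_longest (.inr ⟨⟨rfl, ⟨E₂, rfl, fun B hB => ⟨(hcor B hB).1,
      (hcor B hB).2.1⟩⟩, C₀ ++ E₁, hC₁, by rw [hlen₁, hlen₂']⟩, hC₂⟩)
      (List.prefix_append _ _) (inv.cur_prefix i hi) (inv.cur_le i hi) hk hlen₂' hmax
  -- Common prefix is applied to one party in one slot, which holds both chains.
  have hpre := hCP (ℓ + s) (ℓ + s) le_rfl hN i i _ _ held₁ held₂
  rw [hcons] at hmap
  cases E₁ with
  | nil => simp at hmap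
  | cons B E =>
    simp only [List.map_cons, List.cons.injEq] at hmap
    have hC₀ : ∀ B' ∈ C₀, decide (B'.slot + ℓ ≤ t + (ℓ + s) + 1) = true := by
      intro B' hB'
      have := hA.slots_le C₀ hA.mem_chains B' hB'
      simp only [decide_eq_true_eq]
      omega
    -- The first honest block has a slot at most `t + s + 1`, which is exactly the last slot that
    -- survives pruning by `ℓ` at slot `t + ℓ + s + 1`.
    have hB : decide (B.slot + ℓ ≤ t + (ℓ + s) + 1) = true := by
      simp only [decide_eq_true_eq]
      omega
    unfold prune at hpre
    rw [List.takeWhile_append_of_pos hC₀, List.takeWhile_cons_of_pos (p := fun b : Block P => decide (b.slot + ℓ ≤ t + (ℓ + s) + 1)) hB,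
      List.prefix_append_right_inj] at hpre
    -- An honest block would have to occur in the corrupted extension `E₂`.
    have hBmem : B ∈ E₂ := hpre.subset List.mem_cons_self
    exact hhon B List.mem_cons_self (hcor B hBmem).1

/-- A lower bound for the success probability of the private chain attack. -/
lemma ofReal_sum_attackPatterns_le_cpFailure {ℓ s : ℕ} (he : 1 ≤ e) (hN : ℓ + s < Q.R)
    (hℓk : ℓ ≤ Q.k) (hA : Agreement S ((e - 1) * Q.R) st₀ C₀) :
    ENNReal.ofReal (∑ ω ∈ attackPatterns (ℓ + s) s ℓ, patternWeight (fun p =>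
        (1 - Q.f) ^ (1 / 2 + if p.2 then 1 / 2 - advVirtualStake Q S st₀.pows C₀ e
          else -(1 / 2 - advVirtualStake Q S st₀.pows C₀ e))) ω) ≤
      cpFailure Q S (privateAttack S ((e - 1) * Q.R) (ℓ + s) C₀) ((e - 1) * Q.R) st₀ ℓ Q.R := by
  classical
  have hv := virtualStake_nonneg Q S hA.target_pos C₀ e
  have key := ofReal_sum_patternWeight_le (τ := thresholds Q S st₀ C₀ e)
    (fun i => phi_nonneg Q.f_pos Q.f_lt_one (hv i)) (fun i => phi_le_one Q.f_lt_one)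
    S.disjoint_side ((e - 1) * Q.R) (attackPatterns (ℓ + s) s ℓ)
  have hy : (fun p : Fin (ℓ + s) × Bool =>
      ∏ i ∈ S.side p.2, (1 - thresholds Q S st₀ C₀ e i)) = fun p =>
      (1 - Q.f) ^ (1 / 2 + if p.2 then 1 / 2 - advVirtualStake Q S st₀.pows C₀ e
        else -(1 / 2 - advVirtualStake Q S st₀.pows C₀ e)) := by
    funext p
    simp only [thresholds]
    rw [prod_one_sub_phi Q.f_lt_one]
    congr 1
    -- The virtual stakes of the two sides add up to one, so they are `1 / 2 - d` and `1 / 2 + d`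
    -- for `d = 1 / 2 - advVirtualStake`.
    have h0 : ∑ i ∈ S.side false, virtualStake Q S st₀.pows C₀ e i =
        advVirtualStake Q S st₀.pows C₀ e :=
      Finset.sum_congr (by ext i; exact Setup.mem_side_false) fun _ _ => rfl
    have h1 : ∑ i ∈ S.side true, virtualStake Q S st₀.pows C₀ e i +
        ∑ i ∈ S.side false, virtualStake Q S st₀.pows C₀ e i = 1 := by
      rw [← Finset.sum_union S.disjoint_side, ← sum_virtualStake Q S st₀.pows C₀ e]
      refine Finset.sum_congr ?_ fun _ _ => rfl
      ext i
      simp only [Finset.mem_union, Setup.mem_side_true, Setup.mem_side_false, Finset.mem_univ,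
        iff_true]
      exact (em _).symm
    rcases p with ⟨_, b⟩
    cases b
    · simp only [h0, Bool.false_eq_true, if_false]
      ring
    · have h2 : ∑ i ∈ S.side true, virtualStake Q S st₀.pows C₀ e i =
          1 / 2 + (1 / 2 - advVirtualStake Q S st₀.pows C₀ e) := by linarith
      simpa only [if_true] using h2
  rw [hy] at key
  exact key.trans (MeasureTheory.measure_mono fun x hx =>
    not_commonPrefix_of_attackPattern he rfl hN hℓk hA hx)

end Attack

end Minotaur

namespace Minotaur

/-! ### An environment for the first epoch -/

/-- One honest and one corrupted party with stake `1 / 2 + δ` and `1 / 2 - δ`; the honest party is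
the only miner. -/
noncomputable def twoPartySetup (δ : ℝ) (h0 : 0 ≤ δ) (h1 : δ ≤ 1 / 2) : Setup (Fin 2) where
  corrupt := {1}
  stake i := if i = 1 then 1 / 2 - δ else 1 / 2 + δ
  stake_nonneg i := by split_ifs <;> linarith
  stake_pos := by simp [Fin.sum_univ_two]
  honestMiners _ := {0}
  corruptMiners _ := ∅
  honestMiners_honest _ := by simp
  corruptMiners_corrupt _ := by simp
  miners_pos _ := by simp
  hEst := 1
  hEst_pos := one_pos

section TwoParty

variable {δ : ℝ} {h0 : 0 ≤ δ} {h1 : δ ≤ 1 / 2}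

lemma twoPartySetup_sum_stake : ∑ i, (twoPartySetup δ h0 h1).stake i = 1 := by
  simp [twoPartySetup, Fin.sum_univ_two]
  ring

lemma twoPartySetup_betaS : (twoPartySetup δ h0 h1).betaS = 1 / 2 - δ := by
  rw [Setup.betaS, twoPartySetup_sum_stake]
  simp [twoPartySetup]

lemma twoPartySetup_h (r : ℕ) : (twoPartySetup δ h0 h1).h r = 1 := by
  simp [twoPartySetup, Setup.h]

lemma twoPartySetup_n (r : ℕ) : (twoPartySetup δ h0 h1).n r = 1 := by
  simp [twoPartySetup, Setup.n]

/-- Without corrupted miners the work term vanishes, and `(1 - ω) * (1 / 2 - δ) ≤ 1 / 2 - δ`, for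
windows of any length. -/
lemma twoPartySetup_bounded {ω : ℝ} (hω : 0 ≤ ω) (m : ℕ) :
    (twoPartySetup δ h0 h1).Bounded (1 / 2 - δ) m ω := by
  intro a b hab _ _
  have hW : (twoPartySetup δ h0 h1).betaW a b hab = 0 := by
    simp [Setup.betaW, twoPartySetup_h, twoPartySetup_n]
  rw [hW, twoPartySetup_betaS]
  nlinarith

lemma twoPartySetup_standing (R : ℕ) {γ α₀ ε : ℝ} (hγ : 1 ≤ γ) (hα0 : 0 < α₀) (hα1 : α₀ ≤ 1)
    (hε0 : 0 < ε) (hε1 : ε < 1) : (twoPartySetup δ h0 h1).Standing R δ γ α₀ ε where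
  init_stake := twoPartySetup_betaS.le
  init_work_lower := by
    rw [twoPartySetup_h, div_le_iff₀ (by positivity)]
    simp only [twoPartySetup]
    nlinarith
  init_work_upper := by
    have : 0 < 1 - ε := by linarith
    rw [twoPartySetup_h, le_div_iff₀ (by positivity)]
    simp only [twoPartySetup]
    nlinarith
  respecting_h r r' _ _ _ _ := by simpa [twoPartySetup_h] using hγ
  respecting_n r r' _ _ _ _ := by simpa [twoPartySetup_n] using hγ
  participation r _ := by simpa [twoPartySetup_h, twoPartySetup_n] using hα1

end TwoParty

lemma agreement_genesis {P : Type} [Fintype P] (S : Setup P) : Agreement S 0 (genesis P) [] where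
  cur_eq _ _ := rfl
  chains_finite := Set.finite_singleton _
  mem_chains := rfl
  mem_pub := rfl
  pub_chains := le_rfl
  pub_shorter C hC hne := absurd hC hne
  slots_sorted C hC := by
    rw [Set.mem_singleton_iff.mp hC]; exact List.Pairwise.nil
  slots_pos C hC := by rw [Set.mem_singleton_iff.mp hC]; simp
  slots_le C hC := by rw [Set.mem_singleton_iff.mp hC]; simp
  pows_lt C hC := by rw [Set.mem_singleton_iff.mp hC]; simp
  target_pos w hw := by simp [genesis] at hw

lemma advVirtualStake_epoch_one {P : Type} [Fintype P] (Q : Params) (S : Setup P)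
    (W : List (PowBlock P)) (C : Chain P) : advVirtualStake Q S W C 1 = S.betaS := by
  simp [advVirtualStake, virtualStake, stakeShare, Setup.betaS, Finset.sum_div]

end Minotaur

/-! ### Assembly of the two claims -/

theorem mainTheorem7 :
    ∃ c : ℝ, 0 < c ∧ ∀ f : ℝ, 0 < f → f < 1 → ∃ ℓ₀ : ℕ,
      ∀ (Q : Minotaur.Params) (ℓ : ℕ) (δ : ℝ), Q.f = f → ℓ₀ ≤ ℓ → ℓ ≤ Q.k → 2 * ℓ ≤ Q.R →
        0 ≤ δ → δ ≤ 1 / Real.sqrt ℓ →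
        -- some adversary within the bounds breaks common prefix within the first epoch
        (∀ (m : ℕ) (γ α₀ ε : ℝ), 1 ≤ γ → 0 < α₀ → α₀ ≤ 1 → 0 < ε → ε < 1 →
          ∃ (n : ℕ) (S : Minotaur.Setup (Fin n)) (A : Minotaur.Adversary (Fin n)),
            S.Bounded (1 / 2 - δ) m Q.ω ∧ S.Standing Q.R δ γ α₀ ε ∧
            ENNReal.ofReal c ≤
              Minotaur.cpFailure Q S A 0 (Minotaur.genesis (Fin n)) ℓ Q.R) ∧
        -- the attack can start in every epoch in which the adversary has enough virtual stake
        (∀ (P : Type) [Fintype P] (S : Minotaur.Setup P) (e : ℕ) (st : Minotaur.State P)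
            (C₀ : Minotaur.Chain P), 1 ≤ e →
          Minotaur.Agreement S ((e - 1) * Q.R) st C₀ →
          1 / 2 - δ ≤ Minotaur.advVirtualStake Q S st.pows C₀ e →
          Minotaur.advVirtualStake Q S st.pows C₀ e ≤ 1 / 2 →
          ∃ A : Minotaur.Adversary P,
            ENNReal.ofReal c ≤ Minotaur.cpFailure Q S A ((e - 1) * Q.R) st ℓ Q.R) := by
  refine ⟨Real.exp (-1024) / 16, by positivity, fun f hf0 hf1 => ?_⟩
  obtain ⟨ℓ₀, s, h4, hs, hbound⟩ := Minotaur.exists_attack_bound hf0 hf1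
  refine ⟨ℓ₀, fun Q ℓ δ hQ hℓ hk hR hδ0 hδ => ?_⟩
  have attack : ∀ (P : Type) [Fintype P] (S : Minotaur.Setup P) (e : ℕ) (st : Minotaur.State P)
      (C₀ : Minotaur.Chain P), 1 ≤ e → Minotaur.Agreement S ((e - 1) * Q.R) st C₀ →
      1 / 2 - δ ≤ Minotaur.advVirtualStake Q S st.pows C₀ e →
      Minotaur.advVirtualStake Q S st.pows C₀ e ≤ 1 / 2 →
      ∃ A : Minotaur.Adversary P, ENNReal.ofReal (Real.exp (-1024) / 16) ≤
        Minotaur.cpFailure Q S A ((e - 1) * Q.R) st ℓ Q.R := by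
    intro P _ S e st C₀ he hA hlow hhigh
    have hb := hbound ℓ (1 / 2 - Minotaur.advVirtualStake Q S st.pows C₀ e) hℓ (by linarith)
      (by linarith)
    rw [← hQ] at hb
    -- From `s < ℓ₀ ≤ ℓ` and `2 * ℓ ≤ R` one gets `ℓ + s < R`: the delivery slot still belongs to
    -- the epoch.
    exact ⟨_, (ENNReal.ofReal_le_ofReal hb).trans
      (Minotaur.ofReal_sum_attackPatterns_le_cpFailure he (by omega) hk hA)⟩
  refine ⟨fun m γ α₀ ε hγ hα0 hα1 hε0 hε1 => ?_, attack⟩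
  -- This makes the corrupted stake `1 / 2 - δ` nonnegative; it rests on `4 ≤ ℓ₀`.
  have hδ2 : δ ≤ 1 / 2 := by
    refine hδ.trans (one_div_le_one_div_of_le two_pos ?_)
    refine Real.le_sqrt_of_sq_le ?_
    have : ((4 : ℕ) : ℝ) ≤ ℓ := by exact_mod_cast h4.trans hℓ
    norm_num at this ⊢
    exact this
  have hα : Minotaur.advVirtualStake Q (Minotaur.twoPartySetup δ hδ0 hδ2)
      (Minotaur.genesis (Fin 2)).pows [] 1 = 1 / 2 - δ := by
    rw [Minotaur.advVirtualStake_epoch_one, Minotaur.twoPartySetup_betaS]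
  -- The first claim is the second one in epoch 1 from the genesis state, where virtual stake is the
  -- initial stake.
  obtain ⟨A, hA⟩ := attack (Fin 2) (Minotaur.twoPartySetup δ hδ0 hδ2) 1
    (Minotaur.genesis (Fin 2)) [] le_rfl
    (by simpa using Minotaur.agreement_genesis (Minotaur.twoPartySetup δ hδ0 hδ2))
    hα.ge (by rw [hα]; linarith)
  exact ⟨2, _, A, Minotaur.twoPartySetup_bounded Q.ω_nonneg m,
    Minotaur.twoPartySetup_standing Q.R hγ hα0 hα1 hε0 hε1, by simpa using hA⟩
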